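/- Let $q(\vec x)\,{:}\!-\,R_1(\ldots),\dots,R_m(\ldots)$ be a conjunctive query without self-joins (atoms may contain variables and constants), with head variables $\vec x$ and existential variables $\mathrm{EVar}(q)$. A \emph{dissociation} of $q$ is a collection $\Delta=(\vec y_1,\dots,\vec y_m)$ with $\vec y_i\subseteq \mathrm{EVar}(q)\setminus\mathrm{Var}(R_i)$, ordered componentwise by inclusion; it is \emph{safe} if the query $q^\Delta$, in which the variables $\vec y_i$ are added to the $i$-th atom, is hierarchical, i.e. for any two existential variables the sets of atoms containing them are disjoint or comparable by inclusion. A \emph{plan} $P$ for $q$ is built from the atoms of $q$, each used exactly once, by alternating $k$-ary natural joins ($k\ge 2$, operands unordered) and duplicate-eliminating projections that each project away a nonempty set of head variables of their operand. Here the head variables of an atom are its variables, those of a projection are the ones that are kept, and those of a join are the union over its operands. The head variables of $P$ are those of $q$; no variable is projected away more than once, and head variables of $q$ never. The dissociation $\Delta_P$ of $P$ adds, at every join, to each atom of each operand the existential variables that are head variables of the join but not of that operand. A plan is \emph{minimal} if $\Delta_P$ is minimal among all safe dissociations of $q$. On a tuple-independent probabilistic database $D$, $\mathrm{score}(P)$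 is the extensional score of $P$ as a function of the answer tuple: joins multiply probabilities, and a projection combines the tuples with probabilities $p_1,\dots,p_k$ that agree on the kept variables into $1-\prod_i(1-p_i)$. \emph{Schema knowledge} $K$ consists of a set of relations known to be deterministic (all their tuples have probability $1$) and a set of functional dependencies, each known to hold in one of the relations. A plan $P'$ for $q$ \emph{dominates} a plan $P$ for $q$ under $K$ if $\mathrm{score}(P')\le\mathrm{score}(P)$ for every answer tuple on every database that satisfies $K$. A plan for $q$ is \emph{minimal under $K$} if every plan that dominates it under $K$ is also dominated by it under $K$. Minimal plans under $K$ with the same scores on all databases that satisfy $K$ are counted once. \textbf{Corollary (Minimal plans with schema knowledge).} Knowledge about deterministic tables and functional dependencies cannot increase the number of minimal query plans: 1. for every $K$, the number of minimal plans of $q$ under $K$ is at most the number of minimal plans of $q$; 2. if all knowledge in $K$ is also contained in $K'$, then the number of minimal plans of $q$ under $K'$ is at most the number of minimal plans of $q$ under $K$. -/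

import Mathlib

/-! Self-join-free conjunctive queries over tuple-independent probabilistic databases.
`ι` indexes the relation symbols (and hence the subgoals), `ar i` is the arity of relation `i`,
`V` is the type of variables and `C` the type of constants. -/

/-- A self-join-free conjunctive query `q(head) :- R_1(...), ..., R_m(...)`: one atom per relation
symbol, whose arguments are variables (`Sum.inl`) or constants (`Sum.inr`). -/
structure CQuery (ι V C : Type*) (ar : ι → ℕ) where
  args : ∀ i, Fin (ar i) → V ⊕ C
  head : Finset V
  head_occurs : ∀ v ∈ head, ∃ i j, args i j = Sum.inl v

/-- A tuple-independent probabilistic database instance: for every relation symbol a finite table of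
possible tuples, each with a probability in `[0,1]`. -/
structure ProbDB (ι C : Type*) (ar : ι → ℕ) where
  table : ∀ i, Finset (Fin (ar i) → C)
  prob : ∀ i, (Fin (ar i) → C) → ℝ
  prob_mem : ∀ i, ∀ t ∈ table i, prob i t ∈ Set.Icc (0 : ℝ) 1

/-- A functional dependency `lhs → rhs` between attribute positions of the relation `rel`. -/
structure FunDep (ι : Type*) (ar : ι → ℕ) where
  rel : ι
  lhs : Finset (Fin (ar rel))
  rhs : Finset (Fin (ar rel))

/-- Schema knowledge: which relations are known to be deterministic, and which functional
dependencies are known to hold. -/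
structure SchemaKnowledge (ι : Type*) (ar : ι → ℕ) where
  det : Set ι
  fds : Set (FunDep ι ar)

/-- `K.Le K'`: everything that is known in `K` is also known in `K'`. -/
def SchemaKnowledge.Le {ι : Type*} {ar : ι → ℕ} (K K' : SchemaKnowledge ι ar) : Prop :=
  K.det ⊆ K'.det ∧ K.fds ⊆ K'.fds

namespace ProbDB

variable {ι C : Type*} {ar : ι → ℕ}

/-- All tuples of relation `i` are certain. -/
def IsDeterministic (D : ProbDB ι C ar) (i : ι) : Prop :=
  ∀ t ∈ D.table i, D.prob i t = 1

/-- The functional dependency `γ` holds in the table of possible tuples of its relation. -/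
def SatisfiesFD (D : ProbDB ι C ar) (γ : FunDep ι ar) : Prop :=
  ∀ s ∈ D.table γ.rel, ∀ t ∈ D.table γ.rel, (∀ a ∈ γ.lhs, s a = t a) → ∀ b ∈ γ.rhs, s b = t b

/-- The instances that are possible in the presence of the schema knowledge `K`. -/
def Satisfies (D : ProbDB ι C ar) (K : SchemaKnowledge ι ar) : Prop :=
  (∀ i ∈ K.det, D.IsDeterministic i) ∧ ∀ γ ∈ K.fds, D.SatisfiesFD γ

/-- The active domain: all constants that occur in the instance. -/
def adom [Fintype ι] [DecidableEq C] (D : ProbDB ι C ar) : Finset C :=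
  Finset.univ.biUnion fun i => (D.table i).biUnion fun t => Finset.univ.image t

/-- The probability of a tuple; tuples that are not in the table have probability `0`. -/
def tupleProb [DecidableEq C] (D : ProbDB ι C ar) (i : ι) (t : Fin (ar i) → C) : ℝ :=
  if t ∈ D.table i then D.prob i t else 0

end ProbDB

namespace CQuery

variable {ι V C : Type*} {ar : ι → ℕ} [Fintype ι] [Fintype V] [DecidableEq V] [DecidableEq C]

/-- The variables of the `i`-th subgoal. -/
def atomVars (q : CQuery ι V C ar) (i : ι) : Finset V :=
  Finset.univ.filter fun v => ∃ j, q.args i j = Sum.inl v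

/-- The existential (non-head) variables of the query. -/
def evars (q : CQuery ι V C ar) : Finset V :=
  Finset.univ.biUnion q.atomVars \ q.head

/-- A dissociation adds to every subgoal some existential variables of the query that the subgoal
does not contain. (Head variables act as constants, so nothing is dissociated on them.) -/
def IsDissociation (q : CQuery ι V C ar) (Δ : ι → Finset V) : Prop :=
  ∀ i, Δ i ⊆ q.evars \ q.atomVars i

/-- The set `sg(x)` of the subgoals that contain `x` in the dissociated query `q^Δ`. -/
def subgoals (q : CQuery ι V C ar) (Δ : ι → Finset V) (x : V) : Set ι :=
  {i | x ∈ q.atomVars i ∪ Δ i}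

/-- A safe dissociation: the dissociated query `q^Δ` is hierarchical. -/
def IsSafeDissociation (q : CQuery ι V C ar) (Δ : ι → Finset V) : Prop :=
  q.IsDissociation Δ ∧ ∀ x ∈ q.evars, ∀ y ∈ q.evars,
    q.subgoals Δ x ⊆ q.subgoals Δ y ∨ q.subgoals Δ x ∩ q.subgoals Δ y = ∅ ∨
      q.subgoals Δ y ⊆ q.subgoals Δ x

end CQuery

/-- Query plans. `projAway Y P` is the duplicate-eliminating projection of `P` that projects the
variables `Y` away, `join k Ps` is the `k`-ary natural join. -/
inductive QPlan (ι V : Type*) : Type _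
  | atom (i : ι) : QPlan ι V
  | projAway (Y : Finset V) (P : QPlan ι V) : QPlan ι V
  | join (k : ℕ) (Ps : Fin k → QPlan ι V) : QPlan ι V

namespace QPlan

section Shape

variable {ι V : Type*}

/-- The plan is a projection. -/
def IsProj : QPlan ι V → Prop
  | projAway _ _ => True
  | _ => False

/-- The plan is a join. -/
def IsJoin : QPlan ι V → Prop
  | join _ _ => True
  | _ => False

/-- The relation symbols mentioned in the plan, with multiplicity. -/
def leaves : QPlan ι V → Multiset ι
  | atom i => {i}
  | projAway _ P => P.leaves
  | join _ Ps => ∑ j, (Ps j).leaves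

/-- The variables that are projected away in the plan, with multiplicity. -/
def away : QPlan ι V → Multiset V
  | atom _ => 0
  | projAway Y P => Y.val + P.away
  | join _ Ps => ∑ j, (Ps j).away

/-- Equality of plans up to the order of the operands of joins. -/
inductive Equiv : QPlan ι V → QPlan ι V → Prop
  | atom (i : ι) : Equiv (.atom i) (.atom i)
  | projAway (Y : Finset V) {P Q : QPlan ι V} : Equiv P Q → Equiv (.projAway Y P) (.projAway Y Q)
  | join {k l : ℕ} (e : Fin k ≃ Fin l) {Ps : Fin k → QPlan ι V} {Qs : Fin l → QPlan ι V} :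
      (∀ j, Equiv (Ps j) (Qs (e j))) → Equiv (.join k Ps) (.join l Qs)

theorem Equiv.rfl' (P : QPlan ι V) : Equiv P P := by
  induction P with
  | atom i => exact .atom i
  | projAway Y P ih => exact .projAway Y ih
  | join k Ps ih => exact .join (_root_.Equiv.refl _) ih

theorem Equiv.symm' {P Q : QPlan ι V} (h : Equiv P Q) : Equiv Q P := by
  induction h with
  | atom i => exact .atom i
  | projAway Y _ ih => exact .projAway Y ih
  | @join k l e Ps Qs _ ih =>
    refine .join e.symm fun j => ?_
    have := ih (e.symm j)
    rwa [e.apply_symm_apply] at this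

theorem Equiv.trans' {P Q R : QPlan ι V} (h : Equiv P Q) (h' : Equiv Q R) : Equiv P R := by
  induction h generalizing R with
  | atom i => exact h'
  | projAway Y _ ih =>
    cases h' with
    | projAway _ h2 => exact .projAway Y (ih h2)
  | join e _ ih =>
    cases h' with
    | join e' h2 => exact .join (e.trans e') fun j => ih j (h2 (e j))

/-- Plans are considered up to the order of the operands of joins. -/
instance setoid (ι V : Type*) : Setoid (QPlan ι V) where
  r := Equiv
  iseqv := ⟨Equiv.rfl', Equiv.symm', Equiv.trans'⟩

end Shape

variable {ι V C : Type*} {ar : ι → ℕ} [Fintype ι] [DecidableEq ι] [Fintype V] [DecidableEq V]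
  [DecidableEq C]

/-- The head variables of a plan over the atoms of `q`. -/
def hvars (q : CQuery ι V C ar) : QPlan ι V → Finset V
  | atom i => q.atomVars i
  | projAway Y P => P.hvars q \ Y
  | join _ Ps => Finset.univ.biUnion fun j => (Ps j).hvars q

/-- Well-formedness: joins have at least two operands, projections project away a nonempty set of
head variables of their operand, and joins and projections alternate. -/
def WF (q : CQuery ι V C ar) : QPlan ι V → Prop
  | atom _ => True
  | projAway Y P => Y.Nonempty ∧ Y ⊆ P.hvars q ∧ ¬ P.IsProj ∧ P.WF q
  | join k Ps => 2 ≤ k ∧ ∀ j, ¬ (Ps j).IsJoin ∧ (Ps j).WF q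

/-- `P` is a plan for the query `q`: it is well-formed, mentions every atom of `q` exactly once,
has the head variables of `q`, and every variable is projected away at most once, head variables of
`q` never. -/
def IsPlanFor (q : CQuery ι V C ar) (P : QPlan ι V) : Prop :=
  P.WF q ∧ P.leaves = Finset.univ.val ∧ P.hvars q = q.head ∧
    P.away.Nodup ∧ ∀ v ∈ P.away, v ∉ q.head

/-- The extensional score of a plan: the probability that the plan assigns to the tuple of its
intermediate relation that is given by the values `θ` of its head variables. Joins multiply; a
projection combines all tuples with the same projection as if they were independent. Tuples that are
absent from an intermediate relation have score `0`. -/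
noncomputable def score (q : CQuery ι V C ar) (D : ProbDB ι C ar) : QPlan ι V → (V → C) → ℝ
  | atom i, θ => D.tupleProb i fun j => Sum.elim θ id (q.args i j)
  | projAway Y P, θ =>
      1 - ∏ η ∈ Fintype.piFinset (fun v => if v ∈ Y then D.adom else {θ v}), (1 - P.score q D η)
  | join _ Ps, θ => ∏ j, (Ps j).score q D θ

/-- The dissociation `Δ_P` of a plan: at every join, all relations of the `j`-th operand are
dissociated on the existential join variables that are missing in the head of that operand. -/
def dissoc (q : CQuery ι V C ar) : QPlan ι V → ι → Finset V
  | atom _, _ => ∅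
  | projAway _ P, i => P.dissoc q i
  | join _ Ps, i =>
      (Finset.univ.filter fun j => i ∈ (Ps j).leaves).biUnion fun j =>
        (Ps j).dissoc q i ∪
          (((Finset.univ.biUnion fun l => (Ps l).hvars q) \ (Ps j).hvars q) ∩ q.evars)

/-- A minimal plan (without schema knowledge): a plan for `q` whose dissociation is minimal among all
safe dissociations of `q`. -/
def IsMinimal (q : CQuery ι V C ar) (P : QPlan ι V) : Prop :=
  P.IsPlanFor q ∧ Minimal q.IsSafeDissociation (P.dissoc q)

/-- The score of a plan as a function of the instances that satisfy `K` and of the answer tuple. -/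
noncomputable def scoreOn (q : CQuery ι V C ar) (K : SchemaKnowledge ι ar) (P : QPlan ι V) :
    {D : ProbDB ι C ar // D.Satisfies K} → (V → C) → ℝ :=
  fun D θ => P.score q D.1 θ

/-- A minimal plan in the presence of the schema knowledge `K`: no plan for `q` strictly dominates
it, where `P'` dominates `P` if on all instances that satisfy `K` its scores are at most those
of `P`. -/
def IsMinimalUnder (q : CQuery ι V C ar) (K : SchemaKnowledge ι ar) (P : QPlan ι V) : Prop :=
  P.IsPlanFor q ∧
    ∀ P' : QPlan ι V, P'.IsPlanFor q → P'.scoreOn q K ≤ P.scoreOn q K →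
      P.scoreOn q K ≤ P'.scoreOn q K

end QPlan

namespace CQuery

variable {ι V C : Type*} {ar : ι → ℕ} [Fintype ι] [DecidableEq ι] [Fintype V] [DecidableEq V]
  [DecidableEq C]

/-- The number of minimal plans of `q`, not distinguishing join orders. -/
noncomputable def numMinimalPlans (q : CQuery ι V C ar) : ℕ∞ :=
  Set.encard {c : Quotient (QPlan.setoid ι V) | ∃ P : QPlan ι V, P.IsMinimal q ∧ ⟦P⟧ = c}

/-- The number of minimal plans of `q` in the presence of the schema knowledge `K`. Plans that have
the same scores on all instances that satisfy `K` are equivalent and count once. -/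
noncomputable def numMinimalPlansUnder (q : CQuery ι V C ar) (K : SchemaKnowledge ι ar) : ℕ∞ :=
  Set.encard {f | ∃ P : QPlan ι V, P.IsMinimalUnder q K ∧ P.scoreOn q K = f}

end CQuery

set_option linter.unusedSectionVars false

/-! ### Sums of multisets: membership and multiplicities. -/

section MultisetSum

variable {α β : Type*}

/-! The invariant behind everything is the scope of an existential variable x in a plan: the set of
relations below the projection that removes x. It equals the set of atoms containing x in the query
dissociated by the plan (`IsPlanFor.mem_scope_iff`). Hence a smaller dissociation means smaller
scopes, and a safe dissociation is the same thing as a laminar family of scopes.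

Two facts connect plans and dissociations. First, scores are monotone in scopes
(`Refines.score_le`), by induction on the plan with the larger scopes. Below a join, the scopes of
the other plan stay inside the leaf sets of the operands, so its score factors along them. At a
projection, the projected variables are moved to the top of the other plan one at a time; each move
can only raise the score, because a(1 - ∏(1 - bₖ)) ≤ 1 - ∏(1 - a bₖ) for numbers in [0,1]. Second,
every laminar family of scopes containing the atoms of each variable comes from a plan
(`exists_realizes`), built by recursive partition into maximal blocks.

There are finitely many dissociations, so below that of any plan lies a minimal safe one; a plan
realizing it dominates the given plan on every database. For part 1, a plan minimal under K
therefore has the same scores under K as some minimal plan. For part 2, the score depends on the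
dissociation only, so there are finitely many score functions and every plan is dominated by one
that is minimal under K. A plan minimal under K' then agrees with such a plan on the databases
satisfying K'. Both inequalities say that the smaller set is covered by an image of the larger. -/

theorem Multiset.mem_univ_sum [Fintype β] {f : β → Multiset α} {a : α} :
    a ∈ ∑ j, f j ↔ ∃ j, a ∈ f j := by
  simp [Multiset.mem_sum]

theorem Multiset.nodup_univ_sum [Fintype β] {f : β → Multiset α} :
    (∑ j, f j).Nodup ↔ (∀ j, (f j).Nodup) ∧ ∀ j l, j ≠ l → ∀ a ∈ f j, a ∉ f l := by
  classical
  constructor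
  · intro h
    refine ⟨fun j => ?_, fun j l hjl a haj hal => ?_⟩
    · exact Multiset.nodup_of_le (Finset.single_le_sum (f := f) (fun _ _ => Multiset.zero_le _) (Finset.mem_univ j)) h
    · have h2 : f j + f l ≤ ∑ j, f j := by
        rw [← Finset.sum_pair hjl]
        exact Finset.sum_le_sum_of_subset (Finset.subset_univ _)
      exact Multiset.disjoint_left.1 (Multiset.nodup_add.1 (Multiset.nodup_of_le h2 h)).2.2 haj hal
  · rintro ⟨h1, h2⟩
    rw [Multiset.nodup_iff_count_le_one]
    intro a
    rw [Multiset.count_sum']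
    by_cases ha : ∃ j, a ∈ f j
    · obtain ⟨j, hj⟩ := ha
      rw [Finset.sum_eq_single j]
      · exact Multiset.nodup_iff_count_le_one.1 (h1 j) a
      · exact fun l _ hl => Multiset.count_eq_zero.2 (h2 j l hl.symm a hj)
      · simp
    · rw [Finset.sum_eq_zero]
      · exact Nat.zero_le 1
      · exact fun j _ => Multiset.count_eq_zero.2 fun h => ha ⟨j, h⟩

end MultisetSum

/-! ### Independent disjunction as an operator on functions of assignments. -/

/-- The independent disjunction of `f` over all ways to reset the variables `Y` to values in `A`. -/
noncomputable def orProj {V C : Type*} [Fintype V] [DecidableEq V] (A : Finset C) (Y : Finset V)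
    (f : (V → C) → ℝ) (θ : V → C) : ℝ :=
  1 - ∏ η ∈ Fintype.piFinset (fun v => if v ∈ Y then A else {θ v}), (1 - f η)

section OrProj

variable {V C : Type*} [Fintype V] [DecidableEq V] {A : Finset C} {Y Z : Finset V}
  {f g : (V → C) → ℝ} {θ : V → C}

theorem mem_piFinset_reset {η : V → C} :
    η ∈ Fintype.piFinset (fun v => if v ∈ Y then A else {θ v}) ↔
      ∀ v, (v ∈ Y → η v ∈ A) ∧ (v ∉ Y → η v = θ v) := by
  rw [Fintype.mem_piFinset]
  refine forall_congr' fun v => ?_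
  by_cases h : v ∈ Y <;> simp [h]

theorem orProj_empty : orProj A ∅ f = f := by
  funext θ
  have : Fintype.piFinset (fun v => if v ∈ (∅ : Finset V) then A else {θ v}) = {θ} := by
    ext η
    rw [mem_piFinset_reset]
    simp [funext_iff]
  rw [orProj, this]
  simp

/-- Resets of Y ∪ Z are grouped by their values on Y. Disjointness makes the groups disjoint: the
reset of Z does not overwrite the values on Y. -/
theorem orProj_union [DecidableEq C] (h : Disjoint Y Z) :
    orProj A (Y ∪ Z) f = orProj A Y (orProj A Z f) := by
  funext θ
  have key : Fintype.piFinset (fun v => if v ∈ Y ∪ Z then A else {θ v}) =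
      (Fintype.piFinset (fun v => if v ∈ Y then A else {θ v})).biUnion fun η =>
        Fintype.piFinset (fun v => if v ∈ Z then A else {η v}) := by
    ext ζ
    simp only [Finset.mem_biUnion, mem_piFinset_reset]
    constructor
    · intro hζ
      refine ⟨fun v => if v ∈ Y then ζ v else θ v, fun v => ⟨fun hv => ?_, fun hv => by simp [hv]⟩,
        fun v => ⟨fun hv => (hζ v).1 (Finset.mem_union_right _ hv), fun hv => ?_⟩⟩
      · simpa [hv] using (hζ v).1 (Finset.mem_union_left _ hv)
      · by_cases hY : v ∈ Y
        · simp [hY]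
        · simpa [hY] using (hζ v).2 (by simp [hY, hv])
    · rintro ⟨η, hη, hζ⟩ v
      refine ⟨fun hv => ?_, fun hv => ?_⟩
      · by_cases hZ : v ∈ Z
        · exact (hζ v).1 hZ
        · rw [(hζ v).2 hZ]
          exact (hη v).1 ((Finset.mem_union.1 hv).resolve_right hZ)
      · rw [Finset.mem_union, not_or] at hv
        rw [(hζ v).2 hv.2, (hη v).2 hv.1]
  simp only [orProj, sub_sub_cancel]
  rw [key, Finset.prod_biUnion]
  intro η hη η' hη' hne
  rw [Function.onFun, Finset.disjoint_left]
  intro ζ hζ hζ'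
  rw [Finset.mem_coe, mem_piFinset_reset] at hη hη'
  rw [mem_piFinset_reset] at hζ hζ'
  refine hne (funext fun v => ?_)
  by_cases hY : v ∈ Y
  · have hZ := Finset.disjoint_left.1 h hY
    rw [← (hζ v).2 hZ, ← (hζ' v).2 hZ]
  · rw [(hη v).2 hY, (hη' v).2 hY]

theorem orProj_mono (hg : ∀ η, g η ≤ 1) (h : ∀ η, f η ≤ g η) : orProj A Y f θ ≤ orProj A Y g θ :=
  sub_le_sub_left (Finset.prod_le_prod (fun η _ => sub_nonneg.2 (hg η))
    fun η _ => sub_le_sub_left (h η) 1) 1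

theorem orProj_mem_Icc (h : ∀ η, f η ∈ Set.Icc (0 : ℝ) 1) : orProj A Y f θ ∈ Set.Icc (0 : ℝ) 1 := by
  have h0 : 0 ≤ ∏ η ∈ Fintype.piFinset (fun v => if v ∈ Y then A else {θ v}), (1 - f η) :=
    Finset.prod_nonneg fun η _ => sub_nonneg.2 (h η).2
  have h1 : ∏ η ∈ Fintype.piFinset (fun v => if v ∈ Y then A else {θ v}), (1 - f η) ≤ 1 :=
    Finset.prod_le_one (fun η _ => sub_nonneg.2 (h η).2) fun η _ => sub_le_self _ (h η).1
  exact ⟨sub_nonneg.2 h1, sub_le_self _ h0⟩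

/-- Exchanging the values outside Y is a bijection between the resets of θ and those of θ', and f
does not notice it. -/
theorem orProj_congr_of_eqOn {s : Finset V} {θ' : V → C}
    (hf : ∀ η η' : V → C, (∀ v ∈ s, η v = η' v) → f η = f η')
    (h : ∀ v ∈ s \ Y, θ v = θ' v) : orProj A Y f θ = orProj A Y f θ' := by
  unfold orProj
  congr 1
  refine Finset.prod_bij' (fun η _ v => if v ∈ Y then η v else θ' v)
    (fun η _ v => if v ∈ Y then η v else θ v) ?_ ?_ ?_ ?_ ?_
  · intro η hη
    rw [mem_piFinset_reset] at hη ⊢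
    exact fun v => ⟨fun hv => by simpa [hv] using (hη v).1 hv, fun hv => by simp [hv]⟩
  · intro η hη
    rw [mem_piFinset_reset] at hη ⊢
    exact fun v => ⟨fun hv => by simpa [hv] using (hη v).1 hv, fun hv => by simp [hv]⟩
  · intro η hη
    rw [mem_piFinset_reset] at hη
    funext v
    by_cases hv : v ∈ Y
    · simp [hv]
    · simp [hv, (hη v).2 hv]
  · intro η hη
    rw [mem_piFinset_reset] at hη
    funext v
    by_cases hv : v ∈ Y
    · simp [hv]
    · simp [hv, (hη v).2 hv]
  · intro η hη
    rw [mem_piFinset_reset] at hη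
    congr 1
    refine hf _ _ fun v hv => ?_
    by_cases hY : v ∈ Y
    · simp [hY]
    · simp [hY, (hη v).2 hY, h v (Finset.mem_sdiff.2 ⟨hv, hY⟩)]

/-- A factor `a` in the unit interval can be moved inside an independent disjunction. -/
theorem mul_one_sub_prod_le {κ : Type*} (s : Finset κ) (b : κ → ℝ)
    (hb : ∀ k ∈ s, b k ∈ Set.Icc (0 : ℝ) 1) {a : ℝ} (ha : a ∈ Set.Icc (0 : ℝ) 1) :
    a * (1 - ∏ k ∈ s, (1 - b k)) ≤ 1 - ∏ k ∈ s, (1 - a * b k) := by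
  classical
  induction s using Finset.induction_on with
  | empty => simp
  | insert k s hk ih =>
    rw [Finset.prod_insert hk, Finset.prod_insert hk]
    have ih' := ih fun l hl => hb l (Finset.mem_insert_of_mem hl)
    obtain ⟨hb0, hb1⟩ := hb k (Finset.mem_insert_self k s)
    have hx0 : 0 ≤ ∏ k ∈ s, (1 - b k) :=
      Finset.prod_nonneg fun l hl => sub_nonneg.2 (hb l (Finset.mem_insert_of_mem hl)).2
    have hx1 : ∏ k ∈ s, (1 - b k) ≤ 1 :=
      Finset.prod_le_one (fun l hl => sub_nonneg.2 (hb l (Finset.mem_insert_of_mem hl)).2)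
        fun l hl => sub_le_self _ (hb l (Finset.mem_insert_of_mem hl)).1
    obtain ⟨ha0, ha1⟩ := ha
    have hab : a * b k ≤ 1 := mul_le_one₀ ha1 hb0 hb1
    generalize ∏ k ∈ s, (1 - b k) = X at *
    generalize ∏ k ∈ s, (1 - a * b k) = W at *
    -- After the induction hypothesis is inserted, the two sides of the goal differ by exactly a(1 -
    -- a)b(1 - X), which `h2` shows to be nonnegative.
    have h1 : (1 - a * b k) * W ≤ (1 - a * b k) * (1 - a * (1 - X)) :=
      mul_le_mul_of_nonneg_left (by linarith) (sub_nonneg.2 hab)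
    have h2 : 0 ≤ a * (1 - a) * (b k * (1 - X)) :=
      mul_nonneg (mul_nonneg ha0 (sub_nonneg.2 ha1)) (mul_nonneg hb0 (sub_nonneg.2 hx1))
    nlinarith

/-- Here f plays the role of the join operands that do not mention the projected variables. -/
theorem mul_orProj_le (hg : ∀ η, g η ∈ Set.Icc (0 : ℝ) 1) (hf : ∀ η, f η ∈ Set.Icc (0 : ℝ) 1)
    (hfY : ∀ η, (∀ v, v ∉ Y → η v = θ v) → f η = f θ) :
    f θ * orProj A Y g θ ≤ orProj A Y (fun η => f η * g η) θ := by
  refine (mul_one_sub_prod_le _ _ (fun η _ => hg η) (hf θ)).trans (le_of_eq ?_)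
  unfold orProj
  congr 1
  refine Finset.prod_congr rfl fun η hη => ?_
  simp only [hfY η fun v hv => (mem_piFinset_reset.1 hη v).2 hv]

end OrProj

/-! ### Scopes of projected variables. -/

namespace QPlan

section Scope

variable {ι V : Type*}

theorem mem_leaves_join {k : ℕ} {Ps : Fin k → QPlan ι V} {i : ι} :
    i ∈ (join k Ps).leaves ↔ ∃ j, i ∈ (Ps j).leaves := Multiset.mem_univ_sum

theorem mem_away_join {k : ℕ} {Ps : Fin k → QPlan ι V} {z : V} :
    z ∈ (join k Ps).away ↔ ∃ j, z ∈ (Ps j).away := Multiset.mem_univ_sum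

theorem nodup_leaves_join {k : ℕ} {Ps : Fin k → QPlan ι V} :
    (join k Ps).leaves.Nodup ↔ (∀ j, (Ps j).leaves.Nodup) ∧
      ∀ j l, j ≠ l → ∀ i ∈ (Ps j).leaves, i ∉ (Ps l).leaves := Multiset.nodup_univ_sum

theorem nodup_away_join {k : ℕ} {Ps : Fin k → QPlan ι V} :
    (join k Ps).away.Nodup ↔ (∀ j, (Ps j).away.Nodup) ∧
      ∀ j l, j ≠ l → ∀ z ∈ (Ps j).away, z ∉ (Ps l).away := Multiset.nodup_univ_sum

theorem mem_away_projAway {Y : Finset V} {P : QPlan ι V} {z : V} :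
    z ∈ (projAway Y P).away ↔ z ∈ Y ∨ z ∈ P.away := by
  simp [away]

theorem nodup_away_projAway {Y : Finset V} {P : QPlan ι V} :
    (projAway Y P).away.Nodup ↔ P.away.Nodup ∧ ∀ z ∈ Y, z ∉ P.away := by
  rw [away, Multiset.nodup_add, Multiset.disjoint_left]
  exact ⟨fun h => h.2, fun h => ⟨Y.nodup, h⟩⟩

variable [DecidableEq ι] [DecidableEq V]

/-- The relation symbols below the projections of the plan that project `z` away. -/
def scope (z : V) : QPlan ι V → Finset ι
  | atom _ => ∅
  | projAway Y P => if z ∈ Y then P.leaves.toFinset else P.scope z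
  | join _ Ps => Finset.univ.biUnion fun j => (Ps j).scope z

theorem mem_scope_join {k : ℕ} {Ps : Fin k → QPlan ι V} {z : V} {i : ι} :
    i ∈ (join k Ps).scope z ↔ ∃ j, i ∈ (Ps j).scope z := by
  simp [scope]

theorem scope_projAway_of_mem {Y : Finset V} {P : QPlan ι V} {z : V} (h : z ∈ Y) :
    (projAway Y P).scope z = P.leaves.toFinset := if_pos h

theorem scope_projAway_of_notMem {Y : Finset V} {P : QPlan ι V} {z : V} (h : z ∉ Y) :
    (projAway Y P).scope z = P.scope z := if_neg h

theorem mem_leaves_of_mem_scope {P : QPlan ι V} {z : V} {i : ι} (h : i ∈ P.scope z) :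
    i ∈ P.leaves := by
  induction P with
  | atom => simp [scope] at h
  | projAway Y P ih =>
    by_cases hz : z ∈ Y
    · rw [scope_projAway_of_mem hz] at h
      exact Multiset.mem_toFinset.1 h
    · exact ih (by rwa [scope_projAway_of_notMem hz] at h)
  | join k Ps ih =>
    obtain ⟨j, hj⟩ := mem_scope_join.1 h
    exact mem_leaves_join.2 ⟨j, ih j hj⟩

theorem mem_away_of_mem_scope {P : QPlan ι V} {z : V} {i : ι} (h : i ∈ P.scope z) :
    z ∈ P.away := by
  induction P with
  | atom => simp [scope] at h
  | projAway Y P ih =>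
    by_cases hz : z ∈ Y
    · exact mem_away_projAway.2 (.inl hz)
    · exact mem_away_projAway.2 (.inr (ih (by rwa [scope_projAway_of_notMem hz] at h)))
  | join k Ps ih =>
    obtain ⟨j, hj⟩ := mem_scope_join.1 h
    exact mem_away_join.2 ⟨j, ih j hj⟩

theorem scope_eq_empty {P : QPlan ι V} {z : V} (h : z ∉ P.away) : P.scope z = ∅ :=
  Finset.eq_empty_of_forall_notMem fun _ hi => h (mem_away_of_mem_scope hi)

theorem scope_join {k : ℕ} {Ps : Fin k → QPlan ι V} (h : (join k Ps).away.Nodup) {z : V}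
    {j : Fin k} (hz : z ∈ (Ps j).away) : (join k Ps).scope z = (Ps j).scope z := by
  ext i
  rw [mem_scope_join]
  refine ⟨fun ⟨l, hl⟩ => ?_, fun hi => ⟨j, hi⟩⟩
  by_cases hjl : j = l
  · rwa [hjl]
  · exact absurd (mem_away_of_mem_scope hl) ((nodup_away_join.1 h).2 j l hjl z hz)

/-- The scopes of a plan form a laminar family. -/
theorem scope_laminar {P : QPlan ι V} (hl : P.leaves.Nodup) (ha : P.away.Nodup) (x y : V) :
    P.scope x ⊆ P.scope y ∨ Disjoint (P.scope x) (P.scope y) ∨ P.scope y ⊆ P.scope x := by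
  induction P with
  | atom => simp [scope]
  | projAway Y P ih =>
    have hsub : ∀ z, (projAway Y P).scope z ⊆ P.leaves.toFinset := fun z i hi =>
      Multiset.mem_toFinset.2 (mem_leaves_of_mem_scope (P := projAway Y P) hi)
    by_cases hx : x ∈ Y
    · right; right
      rw [scope_projAway_of_mem hx]
      exact hsub y
    by_cases hy : y ∈ Y
    · left
      rw [scope_projAway_of_mem hy]
      exact hsub x
    rw [scope_projAway_of_notMem hx, scope_projAway_of_notMem hy]
    exact ih hl (nodup_away_projAway.1 ha).1
  | join k Ps ih =>
    by_cases hx : x ∈ (join k Ps).away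
    swap
    · left; rw [scope_eq_empty hx]; exact Finset.empty_subset _
    by_cases hy : y ∈ (join k Ps).away
    swap
    · right; right; rw [scope_eq_empty hy]; exact Finset.empty_subset _
    obtain ⟨j, hj⟩ := mem_away_join.1 hx
    obtain ⟨l, hl'⟩ := mem_away_join.1 hy
    rw [scope_join ha hj, scope_join ha hl']
    by_cases hjl : j = l
    · subst hjl
      exact ih j ((nodup_leaves_join.1 hl).1 j) ((nodup_away_join.1 ha).1 j)
    · right; left
      rw [Finset.disjoint_left]
      exact fun i hi hi' => (nodup_leaves_join.1 hl).2 j l hjl i (mem_leaves_of_mem_scope hi)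
        (mem_leaves_of_mem_scope hi')

end Scope

end QPlan

/-! ### Scores and regular plans. -/

namespace QPlan

section Score

variable {ι V C : Type*} {ar : ι → ℕ} [Fintype ι] [DecidableEq ι] [Fintype V] [DecidableEq V]
  [DecidableEq C] {q : CQuery ι V C ar} {D : ProbDB ι C ar}

theorem score_projAway (Y : Finset V) (P : QPlan ι V) :
    (projAway Y P).score q D = orProj D.adom Y (P.score q D) := rfl

theorem score_join (k : ℕ) (Ps : Fin k → QPlan ι V) (θ : V → C) :
    (join k Ps).score q D θ = ∏ j, (Ps j).score q D θ := rfl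

theorem mem_hvars_join {k : ℕ} {Ps : Fin k → QPlan ι V} {v : V} :
    v ∈ (join k Ps).hvars q ↔ ∃ j, v ∈ (Ps j).hvars q := by
  simp [hvars]

theorem mem_hvars_projAway {Y : Finset V} {P : QPlan ι V} {v : V} :
    v ∈ (projAway Y P).hvars q ↔ v ∈ P.hvars q ∧ v ∉ Y := by
  simp [hvars]

theorem score_mem_Icc (P : QPlan ι V) (θ : V → C) : P.score q D θ ∈ Set.Icc (0 : ℝ) 1 := by
  induction P generalizing θ with
  | atom i =>
    rw [score, ProbDB.tupleProb]
    split_ifs with h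
    · exact D.prob_mem i _ h
    · simp
  | projAway Y P ih => exact orProj_mem_Icc ih
  | join k Ps ih =>
    exact ⟨Finset.prod_nonneg fun j _ => (ih j θ).1,
      Finset.prod_le_one (fun j _ => (ih j θ).1) fun j _ => (ih j θ).2⟩

/-- The score of a plan depends on the values of its head variables only. -/
theorem score_congr (P : QPlan ι V) {θ θ' : V → C} (h : ∀ v ∈ P.hvars q, θ v = θ' v) :
    P.score q D θ = P.score q D θ' := by
  induction P generalizing θ θ' with
  | atom i =>
    rw [score, score]
    congr 1
    funext j
    rcases hj : q.args i j with v | c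
    · exact h v (by simp only [hvars, CQuery.atomVars, Finset.mem_filter_univ]; exact ⟨j, hj⟩)
    · rfl
  | projAway Y P ih => exact orProj_congr_of_eqOn (fun η η' => ih) h
  | join k Ps ih =>
    exact Finset.prod_congr rfl fun j _ => ih j fun v hv => h v (mem_hvars_join.2 ⟨j, hv⟩)

theorem score_equiv {P Q : QPlan ι V} (h : Equiv P Q) : P.score q D = Q.score q D := by
  induction h with
  | atom i => rfl
  | projAway Y _ ih => rw [score_projAway, score_projAway, ih]
  | join e _ ih =>
    funext θ
    exact Fintype.prod_equiv e _ _ fun j => by rw [ih j]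

theorem score_of_away_eq_zero {P : QPlan ι V} (h : ∀ z, z ∉ P.away) (θ : V → C) :
    P.score q D θ = (P.leaves.map fun i => (atom i).score q D θ).prod := by
  induction P with
  | atom i => simp [leaves]
  | projAway Y P ih =>
    have hY : Y = ∅ :=
      Finset.eq_empty_of_forall_notMem fun z hz => h z (mem_away_projAway.2 (.inl hz))
    rw [score_projAway, hY, orProj_empty]
    exact ih fun z hz => h z (mem_away_projAway.2 (.inr hz))
  | join k Ps ih =>
    rw [score_join, leaves, ← Multiset.coe_mapAddMonoidHom, map_sum, Multiset.prod_sum]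
    exact Finset.prod_congr rfl fun j _ => ih j fun z hz => h z (mem_away_join.2 ⟨j, hz⟩)

/-- Every relation is used at most once, no variable is projected away twice or also kept, and every
projected variable has a nonempty scope. -/
structure Regular (q : CQuery ι V C ar) (P : QPlan ι V) : Prop where
  nodup_leaves : P.leaves.Nodup
  nodup_away : P.away.Nodup
  notMem_hvars : ∀ z ∈ P.away, z ∉ P.hvars q
  scope_nonempty : ∀ z ∈ P.away, (P.scope z).Nonempty

namespace Regular

theorem operand {k : ℕ} {Ps : Fin k → QPlan ι V} (h : Regular q (join k Ps)) (j : Fin k) :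
    Regular q (Ps j) where
  nodup_leaves := (nodup_leaves_join.1 h.nodup_leaves).1 j
  nodup_away := (nodup_away_join.1 h.nodup_away).1 j
  notMem_hvars z hz hz' := h.notMem_hvars z (mem_away_join.2 ⟨j, hz⟩) (mem_hvars_join.2 ⟨j, hz'⟩)
  scope_nonempty z hz := by
    rw [← scope_join h.nodup_away hz]
    exact h.scope_nonempty z (mem_away_join.2 ⟨j, hz⟩)

theorem of_projAway {Y : Finset V} {P : QPlan ι V} (h : Regular q (projAway Y P)) :
    Regular q P where
  nodup_leaves := h.nodup_leaves
  nodup_away := (nodup_away_projAway.1 h.nodup_away).1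
  notMem_hvars z hz hz' := h.notMem_hvars z (mem_away_projAway.2 (.inr hz))
    (mem_hvars_projAway.2 ⟨hz', fun hY => (nodup_away_projAway.1 h.nodup_away).2 z hY hz⟩)
  scope_nonempty z hz := by
    rw [← scope_projAway_of_notMem fun hY => (nodup_away_projAway.1 h.nodup_away).2 z hY hz]
    exact h.scope_nonempty z (mem_away_projAway.2 (.inr hz))

end Regular

/-! ### Postponing the projection of one variable. -/

/-- The plan that keeps the variable `y` wherever `P` projects it away. -/
def keep (y : V) : QPlan ι V → QPlan ι V
  | atom i => atom i
  | projAway Y P => projAway (Y.erase y) (P.keep y)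
  | join k Ps => join k fun j => (Ps j).keep y

theorem leaves_keep (y : V) (P : QPlan ι V) : (P.keep y).leaves = P.leaves := by
  induction P with
  | atom => rfl
  | projAway Y P ih => exact ih
  | join k Ps ih => exact Finset.sum_congr rfl fun j _ => ih j

theorem mem_away_keep {y z : V} {P : QPlan ι V} : z ∈ (P.keep y).away ↔ z ≠ y ∧ z ∈ P.away := by
  induction P with
  | atom => simp [keep, away]
  | projAway Y P ih =>
    rw [keep, mem_away_projAway, mem_away_projAway, ih, Finset.mem_erase, and_or_left]
  | join k Ps ih =>
    rw [keep, mem_away_join, mem_away_join]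
    simp [ih]

theorem nodup_away_keep {y : V} {P : QPlan ι V} (h : P.away.Nodup) : (P.keep y).away.Nodup := by
  induction P with
  | atom => exact h
  | projAway Y P ih =>
    rw [nodup_away_projAway] at h
    exact nodup_away_projAway.2 ⟨ih h.1, fun z hz hz' =>
      h.2 z (Finset.mem_of_mem_erase hz) (mem_away_keep.1 hz').2⟩
  | join k Ps ih =>
    rw [nodup_away_join] at h
    exact nodup_away_join.2 ⟨fun j => ih j (h.1 j), fun j l hjl z hz hz' =>
      h.2 j l hjl z (mem_away_keep.1 hz).2 (mem_away_keep.1 hz').2⟩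

theorem mem_hvars_of_mem_hvars_keep {y z : V} {P : QPlan ι V} (h : z ∈ (P.keep y).hvars q)
    (hz : z ≠ y) : z ∈ P.hvars q := by
  induction P with
  | atom => exact h
  | projAway Y P ih =>
    rw [keep, mem_hvars_projAway] at h
    exact mem_hvars_projAway.2 ⟨ih h.1, fun hY => h.2 (Finset.mem_erase.2 ⟨hz, hY⟩)⟩
  | join k Ps ih =>
    obtain ⟨j, hj⟩ := mem_hvars_join.1 h
    exact mem_hvars_join.2 ⟨j, ih j hj⟩

theorem scope_keep {y z : V} {P : QPlan ι V} (hz : z ≠ y) : (P.keep y).scope z = P.scope z := by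
  induction P with
  | atom => rfl
  | projAway Y P ih => simp [keep, scope, hz, leaves_keep, ih]
  | join k Ps ih => simp [keep, scope, ih]

theorem keep_of_notMem {y : V} {P : QPlan ι V} (h : y ∉ P.away) : P.keep y = P := by
  induction P with
  | atom => rfl
  | projAway Y P ih =>
    rw [mem_away_projAway, not_or] at h
    rw [keep, ih h.2, Finset.erase_eq_of_notMem h.1]
  | join k Ps ih =>
    rw [keep]
    congr 1
    exact funext fun j => ih j fun hj => h (mem_away_join.2 ⟨j, hj⟩)

theorem Regular.keep {P : QPlan ι V} (h : Regular q P) (y : V) : Regular q (P.keep y) where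
  nodup_leaves := by rw [leaves_keep]; exact h.nodup_leaves
  nodup_away := nodup_away_keep h.nodup_away
  notMem_hvars z hz hz' := h.notMem_hvars z (mem_away_keep.1 hz).2
    (mem_hvars_of_mem_hvars_keep hz' (mem_away_keep.1 hz).1)
  scope_nonempty z hz := by
    rw [scope_keep (mem_away_keep.1 hz).1]
    exact h.scope_nonempty z (mem_away_keep.1 hz).2

/-- Projecting a variable away at the end instead of earlier can only increase the score. -/
theorem score_le_orProj_keep {P : QPlan ι V} (h : Regular q P) {y : V} (hy : y ∈ P.away)
    (θ : V → C) : P.score q D θ ≤ orProj D.adom {y} ((P.keep y).score q D) θ := by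
  induction P generalizing θ with
  | atom => simp [away] at hy
  | projAway Y P ih =>
    have hnd := nodup_away_projAway.1 h.nodup_away
    rw [QPlan.keep, score_projAway, score_projAway,
      ← orProj_union (Finset.disjoint_singleton_left.2 (Finset.notMem_erase y Y))]
    by_cases hY : y ∈ Y
    · rw [keep_of_notMem (hnd.2 y hY), ← Finset.insert_eq, Finset.insert_erase hY]
    · rw [Finset.erase_eq_of_notMem hY, Finset.union_comm,
        orProj_union (Finset.disjoint_singleton_right.2 hY)]
      exact orProj_mono (fun η => (orProj_mem_Icc (score_mem_Icc _)).2) fun η =>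
        ih h.of_projAway ((mem_away_projAway.1 hy).resolve_left hY) η
  | join k Ps ih =>
    obtain ⟨j, hj⟩ := mem_away_join.1 hy
    -- Only operand j projects y away, so `keep` changes no other factor. The other factors form f,
    -- which does not depend on y since y is not a head variable of the join.
    have hother : ∀ l, l ≠ j → y ∉ (Ps l).away := fun l hl =>
      (nodup_away_join.1 h.nodup_away).2 j l hl.symm y hj
    set f : (V → C) → ℝ := fun η => ∏ l ∈ Finset.univ.erase j, (Ps l).score q D η with hf
    have hf01 : ∀ η, f η ∈ Set.Icc (0 : ℝ) 1 := fun η =>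
      ⟨Finset.prod_nonneg fun l _ => (score_mem_Icc _ η).1,
        Finset.prod_le_one (fun l _ => (score_mem_Icc _ η).1) fun l _ => (score_mem_Icc _ η).2⟩
    have hkeep : (QPlan.keep y (join k Ps)).score q D =
        fun η => f η * ((Ps j).keep y).score q D η := by
      funext η
      rw [QPlan.keep, score_join, ← Finset.prod_erase_mul _ _ (Finset.mem_univ j)]
      congr 1
      refine Finset.prod_congr rfl fun l hl => ?_
      rw [keep_of_notMem (hother l (Finset.ne_of_mem_erase hl))]
    rw [hkeep, score_join, ← Finset.prod_erase_mul _ _ (Finset.mem_univ j)]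
    refine (mul_le_mul_of_nonneg_left (ih j (h.operand j) hj θ) (hf01 θ).1).trans ?_
    refine mul_orProj_le (score_mem_Icc _) hf01 fun η hη => ?_
    refine Finset.prod_congr rfl fun l _ => score_congr _ fun v hv => hη v ?_
    rw [Finset.mem_singleton]
    rintro rfl
    exact h.notMem_hvars v hy (mem_hvars_join.2 ⟨l, hv⟩)

/-! ### Restriction to a set of relations, and factorization of scores. -/

/-- The part of the plan that concerns the relation symbols in `S`. -/
def restrict (S : Finset ι) : QPlan ι V → QPlan ι V
  | atom i => if i ∈ S then atom i else join 0 Fin.elim0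
  | projAway Y P => projAway (if ∃ i ∈ P.leaves, i ∈ S then Y else ∅) (P.restrict S)
  | join k Ps => join k fun j => (Ps j).restrict S

variable {S : Finset ι}

theorem mem_leaves_restrict {P : QPlan ι V} {i : ι} :
    i ∈ (P.restrict S).leaves ↔ i ∈ P.leaves ∧ i ∈ S := by
  induction P with
  | atom l =>
    by_cases hl : l ∈ S
    · simp only [restrict, hl, if_true, leaves, Multiset.mem_singleton]
      exact ⟨fun h => ⟨h, h ▸ hl⟩, fun h => h.1⟩
    · simp only [restrict, hl, if_false, leaves, Multiset.mem_singleton]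
      simpa using fun h : i = l => h ▸ hl
  | projAway Y P ih => exact ih
  | join k Ps ih =>
    rw [restrict, mem_leaves_join, mem_leaves_join]
    simp [ih]

theorem nodup_leaves_restrict {P : QPlan ι V} (h : P.leaves.Nodup) :
    (P.restrict S).leaves.Nodup := by
  induction P with
  | atom l =>
    by_cases hl : l ∈ S
    · simp [restrict, hl, leaves]
    · simp [restrict, hl, leaves]
  | projAway Y P ih => exact ih h
  | join k Ps ih =>
    rw [nodup_leaves_join] at h
    exact nodup_leaves_join.2 ⟨fun j => ih j (h.1 j), fun j l hjl i hi hi' =>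
      h.2 j l hjl i (mem_leaves_restrict.1 hi).1 (mem_leaves_restrict.1 hi').1⟩

theorem mem_away_of_mem_away_restrict {P : QPlan ι V} {z : V} (h : z ∈ (P.restrict S).away) :
    z ∈ P.away := by
  induction P with
  | atom l => by_cases hl : l ∈ S <;> simp [restrict, hl, away] at h
  | projAway Y P ih =>
    rw [restrict, mem_away_projAway] at h
    refine mem_away_projAway.2 (h.imp (fun h => ?_) ih)
    split_ifs at h
    · exact h
    · simp at h
  | join k Ps ih =>
    obtain ⟨j, hj⟩ := mem_away_join.1 h
    exact mem_away_join.2 ⟨j, ih j hj⟩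

theorem nodup_away_restrict {P : QPlan ι V} (h : P.away.Nodup) : (P.restrict S).away.Nodup := by
  induction P with
  | atom l => by_cases hl : l ∈ S <;> simp [restrict, hl, away]
  | projAway Y P ih =>
    rw [nodup_away_projAway] at h
    refine nodup_away_projAway.2 ⟨ih h.1, fun z hz hz' => ?_⟩
    split_ifs at hz
    · exact h.2 z hz (mem_away_of_mem_away_restrict hz')
    · simp at hz
  | join k Ps ih =>
    rw [nodup_away_join] at h
    exact nodup_away_join.2 ⟨fun j => ih j (h.1 j), fun j l hjl z hz hz' =>
      h.2 j l hjl z (mem_away_of_mem_away_restrict hz) (mem_away_of_mem_away_restrict hz')⟩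

theorem scope_restrict {P : QPlan ι V} {z : V} : (P.restrict S).scope z = P.scope z ∩ S := by
  induction P with
  | atom l => by_cases hl : l ∈ S <;> simp [restrict, hl, scope]
  | projAway Y P ih =>
    by_cases hex : ∃ i ∈ P.leaves, i ∈ S
    · rw [restrict, if_pos hex]
      by_cases hz : z ∈ Y
      · rw [scope_projAway_of_mem hz, scope_projAway_of_mem hz]
        ext i
        simp [mem_leaves_restrict]
      · rw [scope_projAway_of_notMem hz, scope_projAway_of_notMem hz, ih]
    · rw [restrict, if_neg hex, scope_projAway_of_notMem (Finset.notMem_empty z), ih]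
      have h1 : ∀ Q : QPlan ι V, Q.leaves = P.leaves → Q.scope z ∩ S = ∅ := fun Q hQ =>
        Finset.eq_empty_of_forall_notMem fun i hi => hex
          ⟨i, hQ ▸ mem_leaves_of_mem_scope (Finset.mem_inter.1 hi).1, (Finset.mem_inter.1 hi).2⟩
      rw [h1 P rfl, h1 (projAway Y P) rfl]
  | join k Ps ih =>
    ext i
    simp [restrict, mem_scope_join, ih]

theorem exists_mem_atomVars_of_mem_hvars {P : QPlan ι V} {z : V} (h : z ∈ P.hvars q) :
    ∃ i ∈ P.leaves, z ∈ q.atomVars i := by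
  induction P with
  | atom i => exact ⟨i, Multiset.mem_singleton_self i, h⟩
  | projAway Y P ih => exact ih (mem_hvars_projAway.1 h).1
  | join k Ps ih =>
    obtain ⟨j, hj⟩ := mem_hvars_join.1 h
    obtain ⟨i, hi, hz⟩ := ih j hj
    exact ⟨i, mem_leaves_join.2 ⟨j, hi⟩, hz⟩

theorem mem_hvars_of_mem_hvars_restrict {P : QPlan ι V} {z : V}
    (h : z ∈ (P.restrict S).hvars q) : z ∈ P.hvars q := by
  induction P with
  | atom l =>
    by_cases hl : l ∈ S
    · simpa [restrict, hl] using h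
    · simp [restrict, hl, hvars] at h
  | projAway Y P ih =>
    rw [restrict, mem_hvars_projAway] at h
    -- A head variable comes from a surviving leaf, so the projection list has not been emptied.
    obtain ⟨i, hi, -⟩ := exists_mem_atomVars_of_mem_hvars h.1
    rw [if_pos ⟨i, mem_leaves_restrict.1 hi⟩] at h
    exact mem_hvars_projAway.2 ⟨ih h.1, h.2⟩
  | join k Ps ih =>
    obtain ⟨j, hj⟩ := mem_hvars_join.1 h
    exact mem_hvars_join.2 ⟨j, ih j hj⟩

theorem mem_away_restrict {P : QPlan ι V} {z : V} (h : (P.scope z ∩ S).Nonempty) :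
    z ∈ (P.restrict S).away := by
  obtain ⟨i, hi⟩ := h
  rw [← scope_restrict] at hi
  exact mem_away_of_mem_scope hi

theorem Regular.scope_restrict_nonempty {P : QPlan ι V} (h : ∀ z ∈ P.away, (P.scope z).Nonempty)
    (ha : P.away.Nodup) {z : V} (hz : z ∈ (P.restrict S).away) :
    ((P.restrict S).scope z).Nonempty := by
  induction P with
  | atom l => by_cases hl : l ∈ S <;> simp [QPlan.restrict, hl, away] at hz
  | projAway Y P ih =>
    rw [nodup_away_projAway] at ha
    rw [QPlan.restrict, mem_away_projAway] at hz
    by_cases hzY : z ∈ if ∃ i ∈ P.leaves, i ∈ S then Y else ∅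
    · rw [QPlan.restrict, scope_projAway_of_mem hzY]
      split_ifs at hzY with hex
      · obtain ⟨i, hi⟩ := hex
        exact ⟨i, Multiset.mem_toFinset.2 (mem_leaves_restrict.2 hi)⟩
      · simp at hzY
    · rw [QPlan.restrict, scope_projAway_of_notMem hzY]
      refine ih (fun w hw => ?_) ha.1 (hz.resolve_left hzY)
      rw [← scope_projAway_of_notMem fun hY => ha.2 w hY hw]
      exact h w (mem_away_projAway.2 (.inr hw))
  | join k Ps ih =>
    obtain ⟨j, hj⟩ := mem_away_join.1 hz
    have := ih j (fun w hw => by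
      rw [← scope_join ha hw]
      exact h w (mem_away_join.2 ⟨j, hw⟩)) ((nodup_away_join.1 ha).1 j) hj
    obtain ⟨i, hi⟩ := this
    exact ⟨i, mem_scope_join.2 ⟨j, hi⟩⟩

theorem Regular.restrict {P : QPlan ι V} (h : Regular q P) (S : Finset ι) :
    Regular q (P.restrict S) where
  nodup_leaves := nodup_leaves_restrict h.nodup_leaves
  nodup_away := nodup_away_restrict h.nodup_away
  notMem_hvars z hz hz' := h.notMem_hvars z (mem_away_of_mem_away_restrict hz)
    (mem_hvars_of_mem_hvars_restrict hz')
  scope_nonempty _ hz := scope_restrict_nonempty h.scope_nonempty h.nodup_away hz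

/-- Only empty joins and empty projections remain. Had `restrict` retained a nonempty projection
list here, the score would drop to 0 on an empty active domain. -/
theorem score_restrict_of_disjoint {P : QPlan ι V} (h : ∀ i ∈ P.leaves, i ∉ S) (θ : V → C) :
    (P.restrict S).score q D θ = 1 := by
  induction P generalizing θ with
  | atom l =>
    have hl : l ∉ S := h l (Multiset.mem_singleton_self l)
    simp [restrict, hl, score]
  | projAway Y P ih =>
    have hex : ¬ ∃ i ∈ P.leaves, i ∈ S := fun ⟨i, hi, hS⟩ => h i hi hS
    rw [restrict, if_neg hex, score_projAway, orProj_empty]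
    exact ih h θ
  | join k Ps ih =>
    rw [restrict, score_join]
    exact Finset.prod_eq_one fun j _ => ih j (fun i hi => h i (mem_leaves_join.2 ⟨j, hi⟩)) θ

theorem restrict_of_subset {P : QPlan ι V} (hr : Regular q P) (h : ∀ i ∈ P.leaves, i ∈ S) :
    P.restrict S = P := by
  induction P with
  | atom l =>
    have hl : l ∈ S := h l (Multiset.mem_singleton_self l)
    simp [restrict, hl]
  | projAway Y P ih =>
    rw [restrict, ih hr.of_projAway h]
    split_ifs with hex
    · rfl
    · rcases Y.eq_empty_or_nonempty with rfl | ⟨z, hz⟩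
      · rfl
      · obtain ⟨i, hi⟩ := hr.scope_nonempty z (mem_away_projAway.2 (.inl hz))
        have hi' : i ∈ P.leaves := mem_leaves_of_mem_scope (P := projAway Y P) hi
        exact absurd ⟨i, hi', h i hi'⟩ hex
  | join k Ps ih =>
    rw [restrict]
    congr 1
    exact funext fun j => ih j (hr.operand j) fun i hi => h i (mem_leaves_join.2 ⟨j, hi⟩)

/-- If every projection of `P` concerns a single block of a partition of the relation symbols, then
the score of `P` is the product of the scores of the parts of `P`. -/
theorem score_eq_prod_restrict {κ : Type*} [Fintype κ] {S : κ → Finset ι}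
    (hS : ∀ j l, j ≠ l → Disjoint (S j) (S l)) {P : QPlan ι V} (hr : Regular q P)
    (hcov : ∀ i ∈ P.leaves, ∃ j, i ∈ S j) (hsc : ∀ z ∈ P.away, ∃ j, P.scope z ⊆ S j) (θ : V → C) :
    P.score q D θ = ∏ j, (P.restrict (S j)).score q D θ := by
  classical
  induction P generalizing θ with
  | atom i =>
    obtain ⟨j, hj⟩ := hcov i (Multiset.mem_singleton_self i)
    rw [Finset.prod_eq_single j]
    · simp [restrict, hj]
    · intro l _ hl
      have : i ∉ S l := Finset.disjoint_left.1 (hS j l hl.symm) hj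
      simp [restrict, this, score]
    · simp
  | projAway Y P ih =>
    rcases Y.eq_empty_or_nonempty with rfl | ⟨z, hz⟩
    · have hsc' : ∀ z ∈ P.away, ∃ j, P.scope z ⊆ S j := fun z hz => by
        obtain ⟨j, hj⟩ := hsc z (mem_away_projAway.2 (.inr hz))
        exact ⟨j, by rwa [scope_projAway_of_notMem (Finset.notMem_empty z)] at hj⟩
      simp only [restrict, ite_self, score_projAway, orProj_empty]
      exact ih hr.of_projAway hcov hsc' θ
    · obtain ⟨j, hj⟩ := hsc z (mem_away_projAway.2 (.inl hz))
      rw [scope_projAway_of_mem hz] at hj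
      have hj' : ∀ i ∈ (projAway Y P).leaves, i ∈ S j := fun i hi => hj (Multiset.mem_toFinset.2 hi)
      rw [Finset.prod_eq_single j]
      · rw [restrict_of_subset hr hj']
      · exact fun l _ hl => score_restrict_of_disjoint
          (fun i hi => Finset.disjoint_left.1 (hS j l hl.symm) (hj' i hi)) θ
      · simp
  | join k Ps ih =>
    simp only [restrict, score_join]
    rw [Finset.prod_comm]
    refine Finset.prod_congr rfl fun l _ => ih l (hr.operand l)
      (fun i hi => hcov i (mem_leaves_join.2 ⟨l, hi⟩)) (fun z hz => ?_) θ
    rw [← scope_join hr.nodup_away hz]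
    exact hsc z (mem_away_join.2 ⟨l, hz⟩)

/-! ### Monotonicity of scores in the scopes. -/

/-- `P'` uses the relations of `P` and projects away the variables of `P`, with scopes contained in
those of `P`. -/
structure Refines (q : CQuery ι V C ar) (P' P : QPlan ι V) : Prop where
  regular : Regular q P'
  leaves_iff : ∀ i, i ∈ P'.leaves ↔ i ∈ P.leaves
  away_iff : ∀ z, z ∈ P'.away ↔ z ∈ P.away
  scope_subset : ∀ z ∈ P.away, P'.scope z ⊆ P.scope z

/-- A plan whose projections have smaller scopes has a smaller score. -/
theorem Refines.score_le {P' P : QPlan ι V} (h : Refines q P' P) (hl : P.leaves.Nodup)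
    (ha : P.away.Nodup) (θ : V → C) : P'.score q D θ ≤ P.score q D θ := by
  induction P generalizing P' θ with
  | atom i =>
    have h0 : ∀ z, z ∉ P'.away := fun z hz => by simpa [away] using (h.away_iff z).1 hz
    have hL : P'.leaves = {i} :=
      (Multiset.Nodup.ext h.regular.nodup_leaves (Multiset.nodup_singleton i)).2 h.leaves_iff
    rw [score_of_away_eq_zero h0, hL]
    simp
  | projAway Y P ih =>
    rw [nodup_away_projAway] at ha
    rw [score_projAway]
    -- The claim is generalized over the set Z of variables still to be pulled out and over P',
    -- because each step replaces P' by `P'.keep y`. When Z is empty, what is left refines the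
    -- operand P.
    have key : ∀ Z : Finset V, (∀ z ∈ Z, z ∉ P.away) → ∀ P' : QPlan ι V, Regular q P' →
        (∀ i, i ∈ P'.leaves ↔ i ∈ P.leaves) → (∀ z, z ∈ P'.away ↔ z ∈ Z ∨ z ∈ P.away) →
        (∀ z ∈ P.away, P'.scope z ⊆ P.scope z) →
        ∀ θ, P'.score q D θ ≤ orProj D.adom Z (P.score q D) θ := by
      intro Z
      induction Z using Finset.induction_on with
      | empty =>
        intro _ P' hr hL hW hσ θ
        rw [orProj_empty]
        exact ih ⟨hr, hL, by simpa using hW, hσ⟩ hl ha.1 θ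
      | insert y Z hy ihZ =>
        intro hZ P' hr hL hW hσ θ
        have hyP : y ∉ P.away := hZ y (Finset.mem_insert_self y Z)
        refine (score_le_orProj_keep hr ((hW y).2 (.inl (Finset.mem_insert_self y Z))) θ).trans ?_
        rw [Finset.insert_eq, orProj_union (Finset.disjoint_singleton_left.2 hy)]
        refine orProj_mono (fun η => (orProj_mem_Icc (score_mem_Icc _)).2) fun η => ?_
        refine ihZ (fun z hz => hZ z (Finset.mem_insert_of_mem hz)) _ (hr.keep y) (fun i => ?_)
          (fun z => ?_) (fun z hz => ?_) η
        · rw [leaves_keep, hL]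
        · rw [mem_away_keep, hW, Finset.mem_insert]
          by_cases hzy : z = y
          · subst hzy; simp [hy, hyP]
          · simp [hzy]
        · rw [scope_keep (ne_of_mem_of_not_mem hz hyP)]
          exact hσ z hz
    refine key Y ha.2 P' h.regular h.leaves_iff
      (fun z => (h.away_iff z).trans mem_away_projAway) (fun z hz => ?_) θ
    rw [← scope_projAway_of_notMem (P := P) fun hY => ha.2 z hY hz]
    exact h.scope_subset z (mem_away_projAway.2 (.inr hz))
  | join k Ps ih =>
    have hl' := nodup_leaves_join.1 hl
    have ha' := nodup_away_join.1 ha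
    have hscope : ∀ j, ∀ z ∈ (Ps j).away, P'.scope z ⊆ (Ps j).scope z := fun j z hz => by
      rw [← scope_join ha hz]
      exact h.scope_subset z (mem_away_join.2 ⟨j, hz⟩)
    have hleaf : ∀ j, ∀ z ∈ (Ps j).away, P'.scope z ⊆ (Ps j).leaves.toFinset := fun j z hz =>
      (hscope j z hz).trans fun i hi => Multiset.mem_toFinset.2 (mem_leaves_of_mem_scope hi)
    rw [score_join, score_eq_prod_restrict (S := fun j => (Ps j).leaves.toFinset) ?_ h.regular ?_ ?_]
    · refine Finset.prod_le_prod (fun j _ => (score_mem_Icc _ θ).1) fun j _ => ?_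
      refine ih j ⟨h.regular.restrict _, fun i => ?_, fun z => ⟨fun hz => ?_, fun hz => ?_⟩,
        fun z hz => ?_⟩ (hl'.1 j) (ha'.1 j) θ
      · rw [mem_leaves_restrict, h.leaves_iff, Multiset.mem_toFinset, mem_leaves_join]
        exact ⟨fun hi => hi.2, fun hi => ⟨⟨j, hi⟩, hi⟩⟩
      -- A variable surviving in block j has a relation of block j in its scope. If operand l
      -- projects it away, its scope in P' lies in block l, so l = j.
      · obtain ⟨i, hi⟩ := (h.regular.restrict _).scope_nonempty z hz
        rw [scope_restrict, Finset.mem_inter, Multiset.mem_toFinset] at hi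
        obtain ⟨l, hzl⟩ := mem_away_join.1 ((h.away_iff z).1 (mem_away_of_mem_scope hi.1))
        by_cases hjl : j = l
        · rwa [hjl]
        · exact absurd (Multiset.mem_toFinset.1 (hleaf l z hzl hi.1)) (hl'.2 j l hjl i hi.2)
      · have hz' := (h.away_iff z).2 (mem_away_join.2 ⟨j, hz⟩)
        refine mem_away_restrict ?_
        rw [Finset.inter_eq_left.2 (hleaf j z hz)]
        exact h.regular.scope_nonempty z hz'
      · rw [scope_restrict]
        exact Finset.inter_subset_left.trans (hscope j z hz)
    · intro j l hjl
      rw [Finset.disjoint_left]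
      exact fun i hi hi' => hl'.2 j l hjl i (Multiset.mem_toFinset.1 hi)
        (Multiset.mem_toFinset.1 hi')
    · intro i hi
      obtain ⟨j, hj⟩ := mem_leaves_join.1 ((h.leaves_iff i).1 hi)
      exact ⟨j, Multiset.mem_toFinset.2 hj⟩
    · intro z hz
      obtain ⟨j, hj⟩ := mem_away_join.1 ((h.away_iff z).1 hz)
      exact ⟨j, hleaf j z hj⟩

end Score

end QPlan

/-! ### The dissociation of a plan in terms of scopes. -/

section Dissociation

variable {ι V C : Type*} {ar : ι → ℕ} [Fintype ι] [DecidableEq ι] [Fintype V] [DecidableEq V]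
  [DecidableEq C] {q : CQuery ι V C ar}

theorem CQuery.mem_evars {x : V} : x ∈ q.evars ↔ (∃ i, x ∈ q.atomVars i) ∧ x ∉ q.head := by
  simp [CQuery.evars]

theorem CQuery.exists_mem_atomVars_of_mem_head {x : V} (h : x ∈ q.head) :
    ∃ i, x ∈ q.atomVars i := by
  obtain ⟨i, j, hj⟩ := q.head_occurs x h
  exact ⟨i, (Finset.mem_filter_univ _).2 ⟨j, hj⟩⟩

namespace QPlan

theorem mem_dissoc_join {k : ℕ} {Ps : Fin k → QPlan ι V} (hl : (join k Ps).leaves.Nodup) {j : Fin k}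
    {i : ι} (hi : i ∈ (Ps j).leaves) {x : V} :
    x ∈ (join k Ps).dissoc q i ↔ x ∈ (Ps j).dissoc q i ∨
      (x ∈ (join k Ps).hvars q ∧ x ∉ (Ps j).hvars q) ∧ x ∈ q.evars := by
  have huniq : ∀ l, i ∈ (Ps l).leaves ↔ l = j := fun l => by
    refine ⟨fun hil => ?_, fun h => h ▸ hi⟩
    by_contra hne
    exact (nodup_leaves_join.1 hl).2 l j hne i hil hi
  simp only [dissoc, Finset.mem_biUnion, Finset.mem_filter_univ, huniq, exists_eq_left,
    Finset.mem_union, Finset.mem_inter, Finset.mem_sdiff, hvars]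

theorem dissoc_subset_evars (P : QPlan ι V) (i : ι) : P.dissoc q i ⊆ q.evars := by
  induction P with
  | atom => exact Finset.empty_subset _
  | projAway Y P ih => exact ih
  | join k Ps ih =>
    exact Finset.biUnion_subset.2 fun j _ => Finset.union_subset (ih j) Finset.inter_subset_right

theorem mem_hvars_or_mem_away {P : QPlan ι V} {i : ι} (hi : i ∈ P.leaves) {x : V}
    (hx : x ∈ q.atomVars i) : x ∈ P.hvars q ∨ x ∈ P.away := by
  induction P with
  | atom l =>
    rw [leaves, Multiset.mem_singleton] at hi
    exact .inl (hi ▸ hx)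
  | projAway Y P ih =>
    rw [mem_hvars_projAway, mem_away_projAway]
    have := ih hi
    tauto
  | join k Ps ih =>
    obtain ⟨j, hj⟩ := mem_leaves_join.1 hi
    exact (ih j hj).imp (fun h => mem_hvars_join.2 ⟨j, h⟩) fun h => mem_away_join.2 ⟨j, h⟩

/-- In the query dissociated by the plan, an existential variable occurs in exactly those relations
that are in its scope, unless it is still a head variable. -/
theorem mem_atomVars_or_mem_dissoc_iff {P : QPlan ι V} (hw : P.WF q) (hl : P.leaves.Nodup) {i : ι}
    (hi : i ∈ P.leaves) {x : V} (hx : x ∈ q.evars) :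
    x ∈ q.atomVars i ∨ x ∈ P.dissoc q i ↔ i ∈ P.scope x ∨ x ∈ P.hvars q := by
  induction P with
  | atom l =>
    rw [leaves, Multiset.mem_singleton] at hi
    simp [dissoc, scope, hvars, hi]
  | projAway Y P ih =>
    rw [mem_hvars_projAway]
    have h := ih hw.2.2.2 hl hi
    by_cases hY : x ∈ Y
    · rw [scope_projAway_of_mem hY, Multiset.mem_toFinset]
      exact ⟨fun _ => .inl hi, fun _ => h.2 (.inr (hw.2.1 hY))⟩
    · rw [scope_projAway_of_notMem hY]
      simpa [hY, dissoc] using h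
  | join k Ps ih =>
    obtain ⟨j, hj⟩ := mem_leaves_join.1 hi
    have h := ih j (hw.2 j).2 ((nodup_leaves_join.1 hl).1 j) hj
    have hsc : i ∈ (join k Ps).scope x ↔ i ∈ (Ps j).scope x := by
      rw [mem_scope_join]
      refine ⟨fun ⟨l, hil⟩ => ?_, fun h => ⟨j, h⟩⟩
      by_cases hjl : j = l
      · rwa [hjl]
      · exact absurd (mem_leaves_of_mem_scope hil) ((nodup_leaves_join.1 hl).2 j l hjl i hj)
    have hv : x ∈ (Ps j).hvars q → x ∈ (join k Ps).hvars q := fun h => mem_hvars_join.2 ⟨j, h⟩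
    rw [mem_dissoc_join hl hj, hsc]
    tauto

/-- A variable of the atom missing from the head of its operand was projected away there, so
regularity forbids it in the head of the join. -/
theorem notMem_dissoc_of_mem_atomVars {P : QPlan ι V} (hr : Regular q P) {i : ι}
    (hi : i ∈ P.leaves) {x : V} (hx : x ∈ q.atomVars i) : x ∉ P.dissoc q i := by
  induction P with
  | atom => exact Finset.notMem_empty x
  | projAway Y P ih => exact ih hr.of_projAway hi
  | join k Ps ih =>
    obtain ⟨j, hj⟩ := mem_leaves_join.1 hi
    rw [mem_dissoc_join hr.nodup_leaves hj, not_or]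
    refine ⟨ih j (hr.operand j) hj, fun h => ?_⟩
    exact hr.notMem_hvars x (mem_away_join.2 ⟨j, (mem_hvars_or_mem_away hj hx).resolve_left h.1.2⟩)
      h.1.1

theorem exists_mem_atomVars_of_mem_away {P : QPlan ι V} (hw : P.WF q) {x : V} (hx : x ∈ P.away) :
    ∃ i ∈ P.leaves, x ∈ q.atomVars i := by
  induction P with
  | atom => simp [away] at hx
  | projAway Y P ih =>
    rcases mem_away_projAway.1 hx with h | h
    · exact exists_mem_atomVars_of_mem_hvars (P := P) (hw.2.1 h)
    · exact ih hw.2.2.2 h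
  | join k Ps ih =>
    obtain ⟨j, hj⟩ := mem_away_join.1 hx
    obtain ⟨i, hi, hxi⟩ := ih j (hw.2 j).2 hj
    exact ⟨i, mem_leaves_join.2 ⟨j, hi⟩, hxi⟩

theorem exists_mem_leaves {P : QPlan ι V} (hw : P.WF q) : ∃ i, i ∈ P.leaves := by
  induction P with
  | atom i => exact ⟨i, Multiset.mem_singleton_self i⟩
  | projAway Y P ih => exact ih hw.2.2.2
  | join k Ps ih =>
    obtain ⟨i, hi⟩ := ih ⟨0, by have := hw.1; omega⟩ (hw.2 _).2
    exact ⟨i, mem_leaves_join.2 ⟨_, hi⟩⟩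

namespace IsPlanFor

variable {P P' : QPlan ι V}

theorem mem_leaves (h : P.IsPlanFor q) (i : ι) : i ∈ P.leaves := by
  rw [h.2.1]
  exact Finset.mem_univ i

theorem nodup_leaves (h : P.IsPlanFor q) : P.leaves.Nodup := by
  rw [h.2.1]
  exact Finset.univ.nodup

theorem mem_away_iff (h : P.IsPlanFor q) {x : V} : x ∈ P.away ↔ x ∈ q.evars := by
  rw [CQuery.mem_evars]
  constructor
  · intro hx
    obtain ⟨i, -, hi⟩ := exists_mem_atomVars_of_mem_away h.1 hx
    exact ⟨⟨i, hi⟩, h.2.2.2.2 x hx⟩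
  · rintro ⟨⟨i, hi⟩, hx⟩
    refine (mem_hvars_or_mem_away (h.mem_leaves i) hi).resolve_left ?_
    rwa [h.2.2.1]

theorem mem_scope_iff (h : P.IsPlanFor q) {x : V} (hx : x ∈ q.evars) {i : ι} :
    i ∈ P.scope x ↔ x ∈ q.atomVars i ∨ x ∈ P.dissoc q i := by
  rw [mem_atomVars_or_mem_dissoc_iff h.1 h.nodup_leaves (h.mem_leaves i) hx, h.2.2.1]
  simp [(CQuery.mem_evars.1 hx).2]

theorem regular (h : P.IsPlanFor q) : Regular q P where
  nodup_leaves := h.nodup_leaves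
  nodup_away := h.2.2.2.1
  notMem_hvars z hz := by
    rw [h.2.2.1]
    exact h.2.2.2.2 z hz
  scope_nonempty z hz := by
    have hz' := h.mem_away_iff.1 hz
    obtain ⟨i, hi⟩ := (CQuery.mem_evars.1 hz').1
    exact ⟨i, (h.mem_scope_iff hz').2 (.inl hi)⟩

theorem isDissociation (h : P.IsPlanFor q) : q.IsDissociation (P.dissoc q) := fun i _ hx =>
  Finset.mem_sdiff.2 ⟨dissoc_subset_evars P i hx, fun hx' =>
    notMem_dissoc_of_mem_atomVars h.regular (h.mem_leaves i) hx' hx⟩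

theorem subgoals_eq (h : P.IsPlanFor q) {x : V} (hx : x ∈ q.evars) :
    q.subgoals (P.dissoc q) x = P.scope x := by
  ext i
  rw [Finset.mem_coe, h.mem_scope_iff hx, CQuery.subgoals, Set.mem_ofPred_eq, Finset.mem_union]

/-- The dissociation of a plan is safe. -/
theorem isSafeDissociation (h : P.IsPlanFor q) : q.IsSafeDissociation (P.dissoc q) := by
  refine ⟨h.isDissociation, fun x hx y hy => ?_⟩
  rw [h.subgoals_eq hx, h.subgoals_eq hy, Finset.coe_subset, Finset.coe_subset,
    ← Set.disjoint_iff_inter_eq_empty, Finset.disjoint_coe]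
  exact scope_laminar h.nodup_leaves h.2.2.2.1 x y

/-- The score of a plan is monotone in its dissociation. -/
theorem score_le (h' : P'.IsPlanFor q) (h : P.IsPlanFor q) (hle : P'.dissoc q ≤ P.dissoc q)
    (D : ProbDB ι C ar) (θ : V → C) : P'.score q D θ ≤ P.score q D θ := by
  refine Refines.score_le ⟨h'.regular, fun i => by simp [h.mem_leaves, h'.mem_leaves],
    fun z => h'.mem_away_iff.trans h.mem_away_iff.symm, fun z hz i hi => ?_⟩ h.nodup_leaves
    h.2.2.2.1 θ
  have hz' := h.mem_away_iff.1 hz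
  rw [h'.mem_scope_iff hz'] at hi
  exact (h.mem_scope_iff hz').2 (hi.imp_right fun hi => hle i hi)

end IsPlanFor

end QPlan

end Dissociation

/-! ### Building a plan from a laminar family of scopes. -/

section Construction

variable {ι V C : Type*} {ar : ι → ℕ} [Fintype ι] [DecidableEq ι] [Fintype V] [DecidableEq V]
  [DecidableEq C] {q : CQuery ι V C ar}

/-- A proper subset of a set `S` with at least two elements that contains `i ∈ S` and is maximal
among the members of a laminar family and the singletons. -/
theorem exists_laminar_block {X : Finset V} {σ : V → Finset ι}
    (hlam : ∀ x ∈ X, ∀ y ∈ X, σ x ⊆ σ y ∨ Disjoint (σ x) (σ y) ∨ σ y ⊆ σ x) {S : Finset ι}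
    (hS : 2 ≤ S.card) {i : ι} (hi : i ∈ S) :
    ∃ T, i ∈ T ∧ T ⊂ S ∧ ((∃ x ∈ X, σ x = T) ∨ T.card = 1) ∧
      ∀ x ∈ X, σ x ⊂ S → σ x ⊆ T ∨ Disjoint (σ x) T := by
  by_cases hex : ∃ x ∈ X, σ x ⊂ S ∧ i ∈ σ x
  · have hne : (X.filter fun x => σ x ⊂ S ∧ i ∈ σ x).Nonempty := by
      obtain ⟨x, hx⟩ := hex
      exact ⟨x, Finset.mem_filter.2 hx⟩
    -- By laminarity the members containing i form a chain, so one of largest cardinality contains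
    -- them all.
    obtain ⟨x, hx, hmax⟩ := Finset.exists_max_image _ (fun x => (σ x).card) hne
    obtain ⟨hxX, hxS, hix⟩ := Finset.mem_filter.1 hx
    refine ⟨σ x, hix, hxS, .inl ⟨x, hxX, rfl⟩, fun y hy hyS => ?_⟩
    rcases hlam y hy x hxX with h | h | h
    · exact .inl h
    · exact .inr h
    · left
      rw [Finset.eq_of_subset_of_card_le h
        (hmax y (Finset.mem_filter.2 ⟨hy, hyS, h hix⟩))]
  · refine ⟨{i}, Finset.mem_singleton_self i, ?_, .inr (Finset.card_singleton i),
      fun x hx hxS => .inr ?_⟩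
    · refine (Finset.singleton_subset_iff.2 hi).ssubset_of_ne fun h => ?_
      rw [← h, Finset.card_singleton] at hS
      omega
    · exact Finset.disjoint_singleton_right.2 fun hix => hex ⟨x, hx, hxS, hix⟩

/-- A laminar family partitions every set `S` with at least two elements into at least two blocks,
each of them a member of the family or a singleton, such that every member of the family that is
properly contained in `S` is contained in a block. -/
theorem exists_laminar_partition {X : Finset V} {σ : V → Finset ι}
    (hlam : ∀ x ∈ X, ∀ y ∈ X, σ x ⊆ σ y ∨ Disjoint (σ x) (σ y) ∨ σ y ⊆ σ x) {S : Finset ι}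
    (hS : 2 ≤ S.card) :
    ∃ (k : ℕ) (T : Fin k → Finset ι), 2 ≤ k ∧ (∀ j, T j ⊂ S) ∧ (∀ j, (T j).Nonempty) ∧
      (∀ j l, j ≠ l → Disjoint (T j) (T l)) ∧ (∀ i ∈ S, ∃ j, i ∈ T j) ∧
      (∀ j, (∃ x ∈ X, σ x = T j) ∨ (T j).card = 1) ∧
      ∀ j, ∀ x ∈ X, σ x ⊂ S → σ x ⊆ T j ∨ Disjoint (σ x) (T j) := by
  have hblock := fun i : S => exists_laminar_block hlam hS i.2
  choose B hiB hBS hBX hBmax using hblock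
  have hsub : ∀ a b : S, Disjoint (B a) (B b) ∨ B a ⊆ B b := by
    intro a b
    rcases hBX a with ⟨x, hx, hxa⟩ | hcard
    · rw [← hxa]
      exact (hBmax b x hx (hxa ▸ hBS a)).symm
    · obtain ⟨c, hc⟩ := Finset.card_eq_one.1 hcard
      rw [hc, Finset.disjoint_singleton_left, Finset.singleton_subset_iff]
      exact (em _).symm
  have hdisj : ∀ a b : S, B a ≠ B b → Disjoint (B a) (B b) := by
    intro a b hab
    rcases hsub a b with h | h
    · exact h
    rcases hsub b a with h' | h'
    · exact h'.symm
    · exact absurd (h.antisymm h') hab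
  let parts : Finset (Finset ι) := Finset.univ.image B
  let e := parts.equivFin.symm
  have hpart : ∀ j, ∃ a, B a = (e j : Finset ι) := fun j => by
    obtain ⟨a, -, ha⟩ := Finset.mem_image.1 (e j).2
    exact ⟨a, ha⟩
  refine ⟨parts.card, fun j => e j, ?_, fun j => ?_, fun j => ?_, fun j l hjl => ?_,
    fun i hi => ?_, fun j => ?_, fun j => ?_⟩
  -- The block of i is a proper subset of S; the block of a point outside it is a second one.
  · obtain ⟨i, hi⟩ := Finset.card_pos.1 (by omega : 0 < S.card)
    obtain ⟨i', hi', hne⟩ := Finset.exists_of_ssubset (hBS ⟨i, hi⟩)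
    refine Finset.one_lt_card.2 ⟨B ⟨i, hi⟩, Finset.mem_image_of_mem B (Finset.mem_univ _),
      B ⟨i', hi'⟩, Finset.mem_image_of_mem B (Finset.mem_univ _), fun h => hne ?_⟩
    rw [h]
    exact hiB _
  · obtain ⟨a, ha⟩ := hpart j
    simp only [← ha]
    exact hBS a
  · obtain ⟨a, ha⟩ := hpart j
    simp only [← ha]
    exact ⟨a, hiB a⟩
  · obtain ⟨a, ha⟩ := hpart j
    obtain ⟨b, hb⟩ := hpart l
    simp only [← ha, ← hb]
    refine hdisj a b fun h => hjl (e.injective (Subtype.ext ?_))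
    rw [← ha, ← hb, h]
  · refine ⟨e.symm ⟨B ⟨i, hi⟩, Finset.mem_image_of_mem B (Finset.mem_univ _)⟩, ?_⟩
    simp only [Equiv.apply_symm_apply]
    exact hiB ⟨i, hi⟩
  · obtain ⟨a, ha⟩ := hpart j
    simp only [← ha]
    exact hBX a
  · obtain ⟨a, ha⟩ := hpart j
    simp only [← ha]
    exact hBmax a

namespace QPlan

/-- `P` is a well-formed plan over the relations `S` that projects away the existential variables
with property `p`, where the scope of `x` is `σ x`. -/
structure Realizes (q : CQuery ι V C ar) (σ : V → Finset ι) (S : Finset ι) (p : V → Prop)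
    (P : QPlan ι V) : Prop where
  wf : P.WF q
  leaves_eq : P.leaves = S.val
  nodup_away : P.away.Nodup
  mem_away : ∀ x, x ∈ P.away ↔ x ∈ q.evars ∧ p x
  mem_hvars : ∀ x, x ∈ P.hvars q ↔ (∃ i ∈ S, x ∈ q.atomVars i) ∧ ¬ (x ∈ q.evars ∧ p x)
  scope_eq : ∀ x ∈ P.away, P.scope x = σ x

variable {σ : V → Finset ι}

/-- Variables with scope exactly S are projected away on top of a plan for the strictly smaller
scopes. If there are none, the plan is left alone, since empty projections are not well-formed. The
last clause records when the result may serve as a join operand. -/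
theorem Realizes.exists_projAway {S : Finset ι} {P : QPlan ι V}
    (hσ : ∀ x ∈ q.evars, ∀ i, x ∈ q.atomVars i → i ∈ σ x)
    (h : Realizes q σ S (fun x => σ x ⊂ S) P) (hproj : ¬ P.IsProj) :
    ∃ P', Realizes q σ S (fun x => σ x ⊆ S) P' ∧
      ((∃ x ∈ q.evars, σ x = S) ∨ ¬ P.IsJoin → ¬ P'.IsJoin) := by
  by_cases hex : ∃ x ∈ q.evars, σ x = S
  · have hmem : ∀ x, x ∈ q.evars.filter (fun x => σ x = S) ↔ x ∈ q.evars ∧ σ x = S := fun x =>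
      Finset.mem_filter
    have hsub : ∀ x, σ x ⊆ S ↔ σ x = S ∨ σ x ⊂ S := fun x => by
      rw [Finset.ssubset_iff_subset_ne]
      by_cases hx : σ x = S
      · simp [hx]
      · simp [hx]
    refine ⟨projAway (q.evars.filter fun x => σ x = S) P, ⟨⟨?_, fun x hx => ?_, hproj, h.wf⟩,
      h.leaves_eq, ?_, fun x => ?_, fun x => ?_, fun x hx => ?_⟩, fun _ => id⟩
    · obtain ⟨x, hx⟩ := hex
      exact ⟨x, (hmem x).2 hx⟩
    · obtain ⟨hx1, hx2⟩ := (hmem x).1 hx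
      rw [h.mem_hvars]
      obtain ⟨i, hxi⟩ := (CQuery.mem_evars.1 hx1).1
      exact ⟨⟨i, hx2 ▸ hσ x hx1 i hxi, hxi⟩, fun hss => hss.2.ne hx2⟩
    · refine nodup_away_projAway.2 ⟨h.nodup_away, fun x hx hx' => ?_⟩
      exact ((h.mem_away x).1 hx').2.ne ((hmem x).1 hx).2
    · rw [mem_away_projAway, hmem, h.mem_away, hsub, and_or_left]
    · rw [mem_hvars_projAway, hmem, h.mem_hvars, hsub]
      tauto
    · by_cases hxS : x ∈ q.evars.filter (fun x => σ x = S)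
      · rw [scope_projAway_of_mem hxS, h.leaves_eq, ((hmem x).1 hxS).2, Finset.val_toFinset]
      · rw [scope_projAway_of_notMem hxS]
        exact h.scope_eq x ((mem_away_projAway.1 hx).resolve_left hxS)
  · have hp : ∀ x, (x ∈ q.evars ∧ σ x ⊂ S) ↔ (x ∈ q.evars ∧ σ x ⊆ S) := fun x =>
      and_congr_right fun hx =>
        ⟨fun hs => hs.subset, fun hs => hs.ssubset_of_ne fun he => hex ⟨x, hx, he⟩⟩
    exact ⟨P, ⟨h.wf, h.leaves_eq, h.nodup_away, fun x => (h.mem_away x).trans (hp x),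
      fun x => by rw [h.mem_hvars, hp], h.scope_eq⟩, fun hj => hj.resolve_left hex⟩

/-- Every laminar family of scopes is realized by a plan. -/
theorem exists_realizes (hσ : ∀ x ∈ q.evars, ∀ i, x ∈ q.atomVars i → i ∈ σ x)
    (hlam : ∀ x ∈ q.evars, ∀ y ∈ q.evars, σ x ⊆ σ y ∨ Disjoint (σ x) (σ y) ∨ σ y ⊆ σ x)
    (n : ℕ) : ∀ S : Finset ι, S.card = n → S.Nonempty →
    ∃ P, Realizes q σ S (fun x => σ x ⊆ S) P ∧
      ((∃ x ∈ q.evars, σ x = S) ∨ S.card = 1 → ¬ P.IsJoin) := by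
  have hne : ∀ x ∈ q.evars, ∃ i, i ∈ σ x := fun x hx =>
    (CQuery.mem_evars.1 hx).1.imp (hσ x hx)
  induction n using Nat.strong_induction_on with
  | _ n ih =>
    intro S hn hS
    suffices h : ∃ P, Realizes q σ S (fun x => σ x ⊂ S) P ∧ ¬ P.IsProj ∧
        (S.card = 1 → ¬ P.IsJoin) by
      obtain ⟨P, hP, hproj, hcard⟩ := h
      obtain ⟨P', hP', hjoin⟩ := hP.exists_projAway hσ hproj
      exact ⟨P', hP', fun h => hjoin (h.imp_right hcard)⟩
    by_cases h1 : S.card = 1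
    · obtain ⟨i, rfl⟩ := Finset.card_eq_one.1 h1
      have hno : ∀ x, ¬ (x ∈ q.evars ∧ σ x ⊂ {i}) := fun x ⟨hx, hs⟩ => by
        obtain ⟨l, hl⟩ := hne x hx
        rw [Finset.ssubset_singleton_iff.1 hs] at hl
        exact Finset.notMem_empty l hl
      refine ⟨atom i, ⟨trivial, rfl, Multiset.nodup_zero, fun x => ?_, fun x => ?_,
        fun x hx => ?_⟩, id, fun _ => id⟩
      · simp only [hno, iff_false]
        exact Multiset.notMem_zero x
      · simp only [hno, not_false_iff, and_true, Finset.mem_singleton, exists_eq_left]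
        rfl
      · exact absurd hx (Multiset.notMem_zero x)
    · have h2 : 2 ≤ S.card := by
        have := hS.card_pos
        omega
      obtain ⟨k, T, hk, hTS, hTne, hTd, hTc, hTX, hTm⟩ := exists_laminar_partition hlam h2
      -- Each block is a scope or a singleton, so its plan ends in a projection or is an atom; this
      -- makes joins and projections alternate.
      have hops : ∀ j, ∃ P, Realizes q σ (T j) (fun x => σ x ⊆ T j) P ∧ ¬ P.IsJoin := fun j => by
        obtain ⟨P, hP, hPj⟩ := ih (T j).card (hn ▸ Finset.card_lt_card (hTS j)) (T j) rfl (hTne j)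
        exact ⟨P, hP, hPj (hTX j)⟩
      choose Ps hPs hPj using hops
      have hblock : ∀ x, (x ∈ q.evars ∧ σ x ⊂ S) ↔ ∃ j, x ∈ q.evars ∧ σ x ⊆ T j := by
        refine fun x => ⟨fun ⟨hx, hxS⟩ => ?_, fun ⟨j, hx, hxj⟩ => ⟨hx, hxj.trans_ssubset (hTS j)⟩⟩
        obtain ⟨i, hi⟩ := hne x hx
        obtain ⟨j, hj⟩ := hTc i (hxS.subset hi)
        exact ⟨j, hx, (hTm j x hx hxS).resolve_right fun hd => Finset.disjoint_left.1 hd hi hj⟩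
      have hnd : (join k Ps).away.Nodup := by
        refine nodup_away_join.2 ⟨fun j => (hPs j).nodup_away, fun j l hjl x hx hx' => ?_⟩
        rw [(hPs j).mem_away] at hx
        rw [(hPs l).mem_away] at hx'
        obtain ⟨i, hi⟩ := hne x hx.1
        exact Finset.disjoint_left.1 (hTd j l hjl) (hx.2 hi) (hx'.2 hi)
      refine ⟨join k Ps, ⟨⟨hk, fun j => ⟨hPj j, (hPs j).wf⟩⟩, ?_, hnd, fun x => ?_, fun x => ?_,
        fun x hx => ?_⟩, id, fun h => absurd h h1⟩
      · refine (Multiset.Nodup.ext (nodup_leaves_join.2 ⟨fun j => ?_, fun j l hjl i hi hi' => ?_⟩)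
          S.nodup).2 fun i => ?_
        · rw [(hPs j).leaves_eq]
          exact (T j).nodup
        · rw [(hPs _).leaves_eq] at hi hi'
          exact Finset.disjoint_left.1 (hTd j l hjl) hi hi'
        · simp only [mem_leaves_join, (hPs _).leaves_eq]
          exact ⟨fun ⟨j, hj⟩ => (hTS j).subset hj, hTc i⟩
      · rw [mem_away_join, hblock]
        exact exists_congr fun j => (hPs j).mem_away x
      · rw [mem_hvars_join]
        simp only [(hPs _).mem_hvars]
        constructor
        · rintro ⟨j, ⟨i, hi, hxi⟩, hj⟩
          refine ⟨⟨i, (hTS j).subset hi, hxi⟩, fun ⟨hx, hxS⟩ => hj ⟨hx, ?_⟩⟩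
          -- The scope of x contains every atom of x, so it meets block j in i and must lie inside
          -- that block.
          exact (hTm j x hx hxS).resolve_right fun hd =>
            Finset.disjoint_left.1 hd (hσ x hx i hxi) hi
        · rintro ⟨⟨i, hi, hxi⟩, hx⟩
          obtain ⟨j, hj⟩ := hTc i hi
          exact ⟨j, ⟨i, hj, hxi⟩, fun hxj => hx ((hblock x).2 ⟨j, hxj⟩)⟩
      · obtain ⟨j, hj⟩ := mem_away_join.1 hx
        rw [scope_join hnd hj]
        exact (hPs j).scope_eq x hj

end QPlan

end Construction

/-! ### Existence of dominating minimal plans, and the count. -/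

section Counting

variable {ι V C : Type*} {ar : ι → ℕ} [Fintype ι] [DecidableEq ι] [Fintype V] [DecidableEq V]
  [DecidableEq C] {q : CQuery ι V C ar}

namespace QPlan

/-- Every safe dissociation is the dissociation of a plan. -/
theorem exists_dissoc_eq [Nonempty ι] {Δ : ι → Finset V} (hΔ : q.IsSafeDissociation Δ) :
    ∃ P : QPlan ι V, P.IsPlanFor q ∧ P.dissoc q = Δ := by
  obtain ⟨hd, hs⟩ := hΔ
  let σ : V → Finset ι := fun x => Finset.univ.filter fun i => x ∈ q.atomVars i ∪ Δ i
  have hσ : ∀ x i, i ∈ σ x ↔ x ∈ q.atomVars i ∨ x ∈ Δ i := fun x i => by simp [σ]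
  have hcoe : ∀ x, q.subgoals Δ x = σ x := fun x => by
    ext i
    simp [σ, CQuery.subgoals]
  obtain ⟨P, hP, -⟩ := exists_realizes (q := q) (σ := σ) (fun x _ i hi => (hσ x i).2 (.inl hi))
    (fun x hx y hy => by
      have := hs x hx y hy
      rwa [hcoe, hcoe, Finset.coe_subset, Finset.coe_subset,
        ← Set.disjoint_iff_inter_eq_empty, Finset.disjoint_coe] at this)
    _ Finset.univ rfl Finset.univ_nonempty
  have haway : ∀ x, x ∈ P.away ↔ x ∈ q.evars := fun x => by simp [hP.mem_away]
  have hplan : P.IsPlanFor q := by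
    refine ⟨hP.wf, hP.leaves_eq, ?_, hP.nodup_away, fun x hx =>
      (CQuery.mem_evars.1 ((haway x).1 hx)).2⟩
    ext x
    rw [hP.mem_hvars]
    have h := CQuery.exists_mem_atomVars_of_mem_head (q := q) (x := x)
    simp only [Finset.mem_univ, true_and, Finset.subset_univ, and_true, CQuery.mem_evars]
    tauto
  refine ⟨P, hplan, funext fun i => Finset.ext fun x => ?_⟩
  -- Equal scopes give equal unions with the atom variables; both dissociations avoid those
  -- variables, so they coincide.
  have hscope : ∀ hx : x ∈ q.evars, (x ∈ q.atomVars i ∨ x ∈ P.dissoc q i) ↔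
      (x ∈ q.atomVars i ∨ x ∈ Δ i) := fun hx => by
    rw [← hplan.mem_scope_iff hx, hP.scope_eq x ((haway x).2 hx), hσ]
  constructor
  · intro hx
    obtain ⟨hx1, hx2⟩ := Finset.mem_sdiff.1 (hplan.isDissociation i hx)
    exact ((hscope hx1).1 (.inr hx)).resolve_left hx2
  · intro hx
    obtain ⟨hx1, hx2⟩ := Finset.mem_sdiff.1 (hd i hx)
    exact ((hscope hx1).2 (.inr hx)).resolve_left hx2

/-- Every plan is dominated by a minimal plan, on all instances. -/
theorem IsPlanFor.exists_isMinimal_score_le {P : QPlan ι V} (h : P.IsPlanFor q) :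
    ∃ P' : QPlan ι V, P'.IsMinimal q ∧
      ∀ (D : ProbDB ι C ar) (θ : V → C), P'.score q D θ ≤ P.score q D θ := by
  obtain ⟨i, -⟩ := exists_mem_leaves h.1
  have : Nonempty ι := ⟨i⟩
  obtain ⟨Δ, hle, hΔ⟩ :=
    exists_minimal_le_of_wellFoundedLT q.IsSafeDissociation (P.dissoc q) h.isSafeDissociation
  obtain ⟨P', hP', rfl⟩ := exists_dissoc_eq hΔ.prop
  exact ⟨P', ⟨hP', hΔ⟩, hP'.score_le h hle⟩

/-- The plans for a query have finitely many different scores. -/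
theorem finite_scoreOn (q : CQuery ι V C ar) (K : SchemaKnowledge ι ar) :
    {f | ∃ P : QPlan ι V, P.IsPlanFor q ∧ P.scoreOn q K = f}.Finite := by
  classical
  refine Set.Finite.of_surjOn (s := {Δ | ∃ P : QPlan ι V, P.IsPlanFor q ∧ P.dissoc q = Δ})
    (fun Δ => if h : ∃ P : QPlan ι V, P.IsPlanFor q ∧ P.dissoc q = Δ then h.choose.scoreOn q K
      else 0) ?_ (Set.toFinite _)
  rintro _ ⟨P, hP, rfl⟩
  have h : ∃ P' : QPlan ι V, P'.IsPlanFor q ∧ P'.dissoc q = P.dissoc q := ⟨P, hP, rfl⟩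
  refine ⟨P.dissoc q, h, ?_⟩
  simp only [dif_pos h]
  funext D θ
  exact (h.choose_spec.1.score_le hP h.choose_spec.2.le D θ).antisymm
    (hP.score_le h.choose_spec.1 h.choose_spec.2.ge D θ)

/-- Every plan is dominated under `K` by a plan that is minimal under `K`. -/
theorem IsPlanFor.exists_isMinimalUnder_scoreOn_le {P : QPlan ι V} (h : P.IsPlanFor q)
    (K : SchemaKnowledge ι ar) :
    ∃ P' : QPlan ι V, P'.IsMinimalUnder q K ∧ P'.scoreOn q K ≤ P.scoreOn q K := by
  obtain ⟨f, hle, ⟨P', hP', rfl⟩, hmin⟩ := (finite_scoreOn q K).exists_le_minimal ⟨P, h, rfl⟩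
  exact ⟨P', ⟨hP', fun Q hQ hQP => hmin ⟨Q, hQ, rfl⟩ hQP⟩, hle⟩

end QPlan

namespace CQuery

open QPlan

/-- The map from classes of minimal plans to their scores under K hits every score of a plan minimal
under K. -/
theorem numMinimalPlansUnder_le (q : CQuery ι V C ar) (K : SchemaKnowledge ι ar) :
    q.numMinimalPlansUnder K ≤ q.numMinimalPlans := by
  have hequiv : ∀ P Q : QPlan ι V, P ≈ Q → P.scoreOn q K = Q.scoreOn q K := fun P Q h => by
    funext D θ
    simp only [scoreOn, score_equiv h]
  refine (Set.encard_le_encard ?_).trans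
    (Set.encard_image_le (Quotient.lift (fun P : QPlan ι V => P.scoreOn q K) hequiv) _)
  rintro _ ⟨P, hP, rfl⟩
  obtain ⟨P', hP', hle⟩ := hP.1.exists_isMinimal_score_le
  have hle' : P'.scoreOn q K ≤ P.scoreOn q K := fun D θ => hle D.1 θ
  exact ⟨⟦P'⟧, ⟨P', hP', rfl⟩, hle'.antisymm (hP.2 P' hP'.1 hle')⟩

/-- More knowledge leaves fewer databases. Restricting score functions to these covers every score
of a plan minimal under K' by one of a plan minimal under K. -/
theorem numMinimalPlansUnder_anti (q : CQuery ι V C ar) {K K' : SchemaKnowledge ι ar}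
    (h : K.Le K') : q.numMinimalPlansUnder K' ≤ q.numMinimalPlansUnder K := by
  have hsat : ∀ D : ProbDB ι C ar, D.Satisfies K' → D.Satisfies K := fun D hD =>
    ⟨fun i hi => hD.1 i (h.1 hi), fun γ hγ => hD.2 γ (h.2 hγ)⟩
  refine (Set.encard_le_encard ?_).trans (Set.encard_image_le
    (fun f (D : {D : ProbDB ι C ar // D.Satisfies K'}) => f ⟨D.1, hsat D.1 D.2⟩) _)
  rintro _ ⟨P, hP, rfl⟩
  obtain ⟨P', hP', hle⟩ := hP.1.exists_isMinimalUnder_scoreOn_le K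
  have hle' : P'.scoreOn q K' ≤ P.scoreOn q K' := fun D θ => hle ⟨D.1, hsat D.1 D.2⟩ θ
  exact ⟨P'.scoreOn q K, ⟨P', hP', rfl⟩, hle'.antisymm (hP.2 P' hP'.1 hle')⟩

end CQuery

end Counting

theorem mainTheorem11 {ι V C : Type*} [Fintype ι] [DecidableEq ι] [Fintype V] [DecidableEq V]
    [DecidableEq C] {ar : ι → ℕ} (q : CQuery ι V C ar) :
    (∀ K : SchemaKnowledge ι ar, q.numMinimalPlansUnder K ≤ q.numMinimalPlans) ∧
    (∀ K K' : SchemaKnowledge ι ar, K.Le K' →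
      q.numMinimalPlansUnder K' ≤ q.numMinimalPlansUnder K) :=
  ⟨q.numMinimalPlansUnder_le, fun _ _ => q.numMinimalPlansUnder_anti⟩
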